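/- **Contracted Bianchi identity.** (1) *On the base manifold.* Let $M$ be a smooth (Hausdorff, finite-dimensional) manifold with a smooth pseudo-Riemannian metric $g$ of any signature, and let $\nabla$ be a smooth connection on $TM$ which is compatible with $g$, with torsion $T(X,Y)=\nabla_XY-\nabla_YX-[X,Y]$ and curvature $R(X,Y)Z=\nabla_X\nabla_YZ-\nabla_Y\nabla_XZ-\nabla_{[X,Y]}Z$. Put $\mathrm{Ric}(Y,Z)=\operatorname{tr}(X\mapsto R(X,Y)Z)$ (that is, $\mathrm{Ric}_{\mu\nu}=R^{\rho}{}_{\nu\rho\mu}$), $\operatorname{tr}(T)_\mu=T^{\nu}{}_{\nu\mu}$ and $(\operatorname{div}^\nabla T)_{\mu\nu}=\nabla_\rho T^{\rho}{}_{\mu\nu}$. Then $$\mathrm{Ric}_{\mu\nu}-\mathrm{Ric}_{\nu\mu}=(\operatorname{div}^\nabla T)_{\mu\nu}-(d\operatorname{tr}T)_{\mu\nu},$$ where $(d\tau)(X,Y)=X(\tau(Y))-Y(\tau(X))-\tau([X,Y])$ for a one-form $\tau$. (2) *On the frame bundle.* Let $P\to M$ be a smooth principal bundle with structure group a Lie group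 $G$ acting on $\mathbb R^{p,q}$ through a smooth homomorphism $\rho:G\to O(p,q)$ whose differential is an isomorphism onto $\mathfrak{so}(p,q)$ (for instance $G=SO^+(p,q)$ and $P$ the bundle of orthonormal frames, or a spin frame bundle). Let $\alpha\in\Omega^1(P,\mathbb R^{p,q})$ be a solder form (smooth, $G$-equivariant, with $\alpha_z:T_zP\to\mathbb R^{p,q}$ surjective and $\ker\alpha_z=\ker d\pi_z$ for every $z\in P$), and let $\omega\in\Omega^1(P,\mathfrak{so}(p,q))$ be a connection one-form. Put $\Theta=d\alpha+\omega\cdot\alpha$ and $\Omega=d\omega+\frac12[\omega\wedge\omega]$. For $a\in\mathbb R^{p,q}$ let $u_a$ be the vector field on $P$ with $\omega(u_a)=0$ and $\alpha(u_a)=a$; write $u_c$ for $u_{e_c}$ when $(e_c)$ is the standard basis. Put $\widehat{\mathrm{Ric}}_{ab}=\sum_c\Omega(u_c,u_a)^c{}_b$, $\operatorname{tr}\Theta=\sum_c\Theta(u_c,\cdot)^c$, $\widehat\Theta(a,b)=\Theta(u_a,u_b)$, $d^\omega\widehat\Theta=d\widehat\Theta+\omega\cdot\widehat\Theta$ (with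 the natural action of $\mathfrak{so}(p,q)$ on $\Lambda^2(\mathbb R^{p,q})^*\otimes\mathbb R^{p,q}$), and $\operatorname{tr}(d^\omega\widehat\Theta)_{ab}=\sum_c\big((d^\omega\widehat\Theta)(u_c)\big)^c{}_{ab}$. Then, at every point of $P$ and for all indices $a,b$, $$\widehat{\mathrm{Ric}}_{ab}-\widehat{\mathrm{Ric}}_{ba}=\operatorname{tr}(d^\omega\widehat\Theta)_{ab}-(d\operatorname{tr}\Theta)(u_a,u_b).$$ -/

import Mathlib

open Bundle FiberBundle VectorField
open scoped Manifold ContDiff Topology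

noncomputable section

/-! ## Differential one-forms -/

section OneForms

variable {E : Type*} [NormedAddCommGroup E] [NormedSpace ℝ E]
  {N : Type*} [TopologicalSpace N] [ChartedSpace E N] [IsManifold 𝓘(ℝ, E) ∞ N]
  {W : Type*} [NormedAddCommGroup W] [NormedSpace ℝ W]

/-- Exterior derivative of a `W`-valued one-form `σ`:
`dσ(X, Y) = X(σ(Y)) - Y(σ(X)) - σ([X, Y])`, where the tangent vectors `v, w` at `x` are extended
to vector fields which are smooth near `x`. -/
def extDerivOneForm (σ : Π x : N, TangentSpace 𝓘(ℝ, E) x → W) (x : N)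
    (v w : TangentSpace 𝓘(ℝ, E) x) : W :=
  mvfderiv 𝓘(ℝ, E) (fun y ↦ σ y (extend E w y)) x v
    - mvfderiv 𝓘(ℝ, E) (fun y ↦ σ y (extend E v y)) x w
    - σ x (mlieBracket 𝓘(ℝ, E) (extend E v) (extend E w) x)

/-- Smoothness of a `W`-valued one-form, as a section of the bundle `Hom(TN, W)`. -/
def IsSmoothOneForm (σ : Π x : N, TangentSpace 𝓘(ℝ, E) x →L[ℝ] W) : Prop :=
  ContMDiff 𝓘(ℝ, E) (𝓘(ℝ, E).prod 𝓘(ℝ, E →L[ℝ] W)) ∞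
    (fun x ↦ TotalSpace.mk' (E →L[ℝ] W)
      (E := fun x : N ↦ TangentSpace 𝓘(ℝ, E) x →L[ℝ] Bundle.Trivial N W x) x (σ x))

end OneForms

/-! ## Metric connections on the tangent bundle -/

section Base

variable {E : Type*} [NormedAddCommGroup E] [NormedSpace ℝ E] [FiniteDimensional ℝ E]
  {M : Type*} [TopologicalSpace M] [ChartedSpace E M] [IsManifold 𝓘(ℝ, E) ∞ M]

variable (E M) in
/-- A smooth pseudo-Riemannian metric (of arbitrary signature) on `M`. -/
structure PseudoRiemannianMetric where
  /-- The bilinear form on each tangent space. -/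
  val : Π x : M, TangentSpace 𝓘(ℝ, E) x →L[ℝ] TangentSpace 𝓘(ℝ, E) x →L[ℝ] ℝ
  symm : ∀ x (v w : TangentSpace 𝓘(ℝ, E) x), val x v w = val x w v
  nondegenerate : ∀ x (v : TangentSpace 𝓘(ℝ, E) x), (∀ w, val x v w = 0) → v = 0
  smooth : ContMDiff 𝓘(ℝ, E) (𝓘(ℝ, E).prod 𝓘(ℝ, E →L[ℝ] E →L[ℝ] ℝ)) ∞
    (fun x ↦ TotalSpace.mk' (E →L[ℝ] E →L[ℝ] ℝ)
      (E := fun x : M ↦ TangentSpace 𝓘(ℝ, E) x →L[ℝ] TangentSpace 𝓘(ℝ, E) x →L[ℝ] ℝ) x (val x))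

/-- `∇` is compatible with `g`: `v(g(X, Y)) = g(∇_v X, Y) + g(X, ∇_v Y)`. -/
def PseudoRiemannianMetric.IsCompatible (g : PseudoRiemannianMetric E M)
    (cov : CovariantDerivative 𝓘(ℝ, E) E (TangentSpace 𝓘(ℝ, E) : M → Type _)) : Prop :=
  ∀ (x : M) (X Y : Π y : M, TangentSpace 𝓘(ℝ, E) y),
    MDiffAt (T% X) x → MDiffAt (T% Y) x → ∀ v : TangentSpace 𝓘(ℝ, E) x,
      mvfderiv 𝓘(ℝ, E) (fun y ↦ g.val y (X y) (Y y)) x v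
        = g.val x (cov X x v) (Y x) + g.val x (X x) (cov Y x v)

variable (cov : CovariantDerivative 𝓘(ℝ, E) E (TangentSpace 𝓘(ℝ, E) : M → Type _))

section Curvature

variable [T2Space M] [CovariantDerivative.ContMDiffCovariantDerivative cov ∞]

/-- For a smooth connection, `∇ Z` is smooth at `x` if `Z` is the extension of a tangent vector
at `x`. -/
theorem contMDiffAt_cov_extend (x : M) (w : TangentSpace 𝓘(ℝ, E) x) :
    ContMDiffAt 𝓘(ℝ, E) (𝓘(ℝ, E).prod 𝓘(ℝ, E →L[ℝ] E)) ∞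
      (fun y ↦ TotalSpace.mk' (E →L[ℝ] E)
        (E := fun y : M ↦ TangentSpace 𝓘(ℝ, E) y →L[ℝ] TangentSpace 𝓘(ℝ, E) y)
        y (cov (extend E w) y)) x := by
  obtain ⟨s, hs, hsw⟩ := exists_contMDiffOn_extend (k := ∞) 𝓘(ℝ, E) E w
  obtain ⟨u, hus, hu, hxu⟩ := mem_nhds_iff.1 hs
  have hw : ContMDiffOn 𝓘(ℝ, E) (𝓘(ℝ, E).prod 𝓘(ℝ, E)) ∞ (T% (extend E w)) u := hsw.mono hus
  obtain ⟨f, hf, -⟩ := (SmoothBumpFunction.nhds_basis_support (I := 𝓘(ℝ, E))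
    (hu.mem_nhds hxu)).mem_iff.1 (hu.mem_nhds hxu)
  have hglob : ContMDiff 𝓘(ℝ, E) (𝓘(ℝ, E).prod 𝓘(ℝ, E)) ∞ (T% ((f : M → ℝ) • extend E w)) :=
    ContMDiffOn.smul_section_of_tsupport f.contMDiff.contMDiffOn hu hf hw
  have hcov := (CovariantDerivative.ContMDiffCovariantDerivative.contMDiff
    (cov := cov) (k := ∞)).contMDiff (σ := (f : M → ℝ) • extend E w) hglob.contMDiffOn
  refine (hcov.contMDiffAt Filter.univ_mem).congr_of_eventuallyEq ?_
  filter_upwards [f.eventuallyEq_one.eventuallyEq_nhds, hu.mem_nhds hxu] with y hy hyu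
  congr 1
  refine cov.isCovariantDerivativeOn.congr_of_eventuallyEq (s := Set.univ)
    ((hw.contMDiffAt (hu.mem_nhds hyu)).mdifferentiableAt (by simp))
    (hglob.contMDiffAt.mdifferentiableAt (by simp)) Filter.univ_mem ?_
  filter_upwards [hy] with z hz
  simp [hz]

/-- If moreover `X` is differentiable at `x`, then so is `∇_X Z`. -/
theorem mdifferentiableAt_cov_extend_apply (x : M) (w : TangentSpace 𝓘(ℝ, E) x)
    {X : Π y : M, TangentSpace 𝓘(ℝ, E) y} (hX : MDiffAt (T% X) x) :
    MDiffAt (T% (fun y ↦ cov (extend E w) y (X y))) x :=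
  MDifferentiableAt.clm_bundle_apply
    ((contMDiffAt_cov_extend cov x w).mdifferentiableAt (by simp)) hX

variable [CompleteSpace E]

/-- The curvature `R(X, Y) Z = ∇_X ∇_Y Z - ∇_Y ∇_X Z - ∇_{[X, Y]} Z` at `x`, as a function of the
vector field `X`, where `Y` and `Z` are extensions of the tangent vectors `v` and `w` at `x`. -/
def curvatureAux (x : M) (v w : TangentSpace 𝓘(ℝ, E) x) (X : Π y : M, TangentSpace 𝓘(ℝ, E) y) :
    TangentSpace 𝓘(ℝ, E) x :=
  cov (fun y ↦ cov (extend E w) y (extend E v y)) x (X x)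
    - cov (fun y ↦ cov (extend E w) y (X y)) x v
    - cov (extend E w) x (mlieBracket 𝓘(ℝ, E) X (extend E v) x)

theorem tensorialAt_curvatureAux (x : M) (v w : TangentSpace 𝓘(ℝ, E) x) :
    TensorialAt 𝓘(ℝ, E) E (curvatureAux cov x v w) x := by
  constructor
  · intro f X hf hX
    have h := cov.isCovariantDerivativeOnUniv.leibniz
      (mdifferentiableAt_cov_extend_apply cov x w hX) hf
    have e : (fun y ↦ cov (extend E w) y ((f • X) y))
        = f • (fun y ↦ cov (extend E w) y (X y)) := by
      ext y
      simp
    simp only [curvatureAux]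
    rw [e, h, mlieBracket_smul_left hf hX]
    simp
    module
  · intro X X' hX hX'
    have h := cov.isCovariantDerivativeOnUniv.add
      (mdifferentiableAt_cov_extend_apply cov x w hX)
      (mdifferentiableAt_cov_extend_apply cov x w hX')
    have e : (fun y ↦ cov (extend E w) y ((X + X') y))
        = (fun y ↦ cov (extend E w) y (X y)) + (fun y ↦ cov (extend E w) y (X' y)) := by
      ext y
      simp
    simp only [curvatureAux]
    rw [e, h, mlieBracket_add_left hX hX']
    simp
    abel

/-- The endomorphism `u ↦ R(u, v) w` of the tangent space at `x`. -/
def curvatureEnd (x : M) (v w : TangentSpace 𝓘(ℝ, E) x) :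
    TangentSpace 𝓘(ℝ, E) x →L[ℝ] TangentSpace 𝓘(ℝ, E) x :=
  TensorialAt.mkHom (curvatureAux cov x v w) x (tensorialAt_curvatureAux cov x v w)

/-- The Ricci curvature `Ric(v, w) = tr (u ↦ R(u, v) w)`, that is `Ric_{μν} = R^ρ_{νρμ}`. -/
def ricci (x : M) (v w : TangentSpace 𝓘(ℝ, E) x) : ℝ :=
  LinearMap.trace ℝ (TangentSpace 𝓘(ℝ, E) x) (curvatureEnd cov x v w).toLinearMap

end Curvature

section Torsion

variable [CompleteSpace E]

/-- The endomorphism `u ↦ T(u, v)` of the tangent space at `x`. -/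
def torsionEnd (x : M) (v : TangentSpace 𝓘(ℝ, E) x) :
    TangentSpace 𝓘(ℝ, E) x →ₗ[ℝ] TangentSpace 𝓘(ℝ, E) x :=
  ((ContinuousLinearMap.coeLM ℝ) ∘ₗ (cov.torsion x).toLinearMap).flip v

/-- The trace of the torsion, `tr(T)(v) = tr (u ↦ T(u, v))`, that is `tr(T)_μ = T^ν_{νμ}`. -/
def trTorsion (x : M) (v : TangentSpace 𝓘(ℝ, E) x) : ℝ :=
  LinearMap.trace ℝ (TangentSpace 𝓘(ℝ, E) x) (torsionEnd cov x v)

/-- The endomorphism `u ↦ (∇_u T)(v, w)`, where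
`(∇_u T)(v, w) = ∇_u (T(Y, Z)) - T(∇_u Y, w) - T(v, ∇_u Z)` for vector fields `Y`, `Z` extending
`v`, `w`. -/
def covDerivTorsion (x : M) (v w : TangentSpace 𝓘(ℝ, E) x) :
    TangentSpace 𝓘(ℝ, E) x →ₗ[ℝ] TangentSpace 𝓘(ℝ, E) x :=
  (cov (fun y ↦ cov.torsion y (extend E v y) (extend E w y)) x).toLinearMap
    - torsionEnd cov x w ∘ₗ (cov (extend E v) x).toLinearMap
    - (cov.torsion x v).toLinearMap ∘ₗ (cov (extend E w) x).toLinearMap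

/-- The covariant divergence of the torsion, `(div T)_{μν} = ∇_ρ T^ρ_{μν}`. -/
def divTorsion (x : M) (v w : TangentSpace 𝓘(ℝ, E) x) : ℝ :=
  LinearMap.trace ℝ (TangentSpace 𝓘(ℝ, E) x) (covDerivTorsion cov x v w)

end Torsion

end Base

/-! ## Frame bundles -/

/-- The vector space `ℝ^{p,q}`. -/
abbrev Rpq (p q : ℕ) : Type := Fin p ⊕ Fin q → ℝ

/-- The standard inner product of signature `(p, q)` on `ℝ^{p,q}`. -/
def etaForm (p q : ℕ) (v w : Rpq p q) : ℝ :=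
  ∑ i, v (Sum.inl i) * w (Sum.inl i) - ∑ j, v (Sum.inr j) * w (Sum.inr j)

/-- The vectors of the canonical basis of `ℝ^{p,q}`. -/
def stdVec (p q : ℕ) (a : Fin p ⊕ Fin q) : Rpq p q := Pi.single a 1

/-- `A` belongs to the Lie algebra `𝔰𝔬(p, q)`, acting on `ℝ^{p,q}`. -/
def IsSkewEta {p q : ℕ} (A : Rpq p q →L[ℝ] Rpq p q) : Prop :=
  ∀ v w, etaForm p q (A v) w + etaForm p q v (A w) = 0

section FrameBundle

variable (EG EP EM : Type*)
  [NormedAddCommGroup EG] [NormedSpace ℝ EG]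
  [NormedAddCommGroup EP] [NormedSpace ℝ EP]
  [NormedAddCommGroup EM] [NormedSpace ℝ EM]
  (G P M : Type*)
  [TopologicalSpace G] [ChartedSpace EG G] [Group G] [LieGroup 𝓘(ℝ, EG) ∞ G]
  [TopologicalSpace P] [ChartedSpace EP P] [IsManifold 𝓘(ℝ, EP) ∞ P]
  [TopologicalSpace M] [ChartedSpace EM M] [IsManifold 𝓘(ℝ, EM) ∞ M]

/-- A smooth principal `G`-bundle `P → M`, with right action `act`.
The local sections `s` and the maps `t` on `π⁻¹(U)` are the data of local trivialisations
`U × G ≃ π⁻¹(U)`, `(y, g) ↦ s(y) · g`, with inverse `z ↦ (π(z), t(z))`. -/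
structure SmoothPrincipalBundle where
  /-- The projection to the base. -/
  proj : P → M
  /-- The right action of the structure group. -/
  act : P → G → P
  smooth_proj : ContMDiff 𝓘(ℝ, EP) 𝓘(ℝ, EM) ∞ proj
  smooth_act : ContMDiff (𝓘(ℝ, EP).prod 𝓘(ℝ, EG)) 𝓘(ℝ, EP) ∞ (fun z : P × G ↦ act z.1 z.2)
  act_one : ∀ z, act z 1 = z
  act_mul : ∀ z g h, act z (g * h) = act (act z g) h
  proj_act : ∀ z g, proj (act z g) = proj z
  locally_trivial : ∀ x : M, ∃ U : Set M, IsOpen U ∧ x ∈ U ∧ ∃ (s : M → P) (t : P → G),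
    ContMDiffOn 𝓘(ℝ, EM) 𝓘(ℝ, EP) ∞ s U ∧
    ContMDiffOn 𝓘(ℝ, EP) 𝓘(ℝ, EG) ∞ t (proj ⁻¹' U) ∧
    (∀ y ∈ U, proj (s y) = y ∧ ∀ g, t (act (s y) g) = g) ∧
    (∀ z ∈ proj ⁻¹' U, act (s (proj z)) (t z) = z)

/-- A bundle of (possibly oriented, time-oriented, or spin) orthonormal frames of signature
`(p, q)`: a principal bundle whose structure group `G` acts on `ℝ^{p,q}` by isometries, with
Lie algebra `𝔰𝔬(p, q)` (for instance `G = SO⁺(p, q)`, `O(p, q)` or `Spin⁺(p, q)`), together with a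
solder form `α`: a smooth `ℝ^{p,q}`-valued one-form which is equivariant, horizontal, and
identifies `TP / ker dπ` with `ℝ^{p,q}`. -/
structure OrthonormalFrameBundle (p q : ℕ) extends SmoothPrincipalBundle EG EP EM G P M where
  /-- The action of the structure group on `ℝ^{p,q}`. -/
  rep : G →* (Rpq p q →L[ℝ] Rpq p q)
  smooth_rep : ContMDiff 𝓘(ℝ, EG) 𝓘(ℝ, Rpq p q →L[ℝ] Rpq p q) ∞ rep
  rep_isometry : ∀ g v w, etaForm p q (rep g v) (rep g w) = etaForm p q v w
  /-- The differential of `rep` at `1` is an isomorphism of the Lie algebra of `G` onto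
  `𝔰𝔬(p, q)`. -/
  rep_lie : Set.BijOn (mvfderiv 𝓘(ℝ, EG) rep 1) Set.univ {A | IsSkewEta A}
  /-- The solder form. -/
  solder : Π z : P, TangentSpace 𝓘(ℝ, EP) z →L[ℝ] Rpq p q
  smooth_solder : IsSmoothOneForm solder
  solder_equivariant : ∀ (z : P) (g : G) (v : TangentSpace 𝓘(ℝ, EP) z),
    solder (act z g) (mfderiv 𝓘(ℝ, EP) 𝓘(ℝ, EP) (fun y ↦ act y g) z v) = rep g⁻¹ (solder z v)
  solder_eq_zero_iff : ∀ (z : P) (v : TangentSpace 𝓘(ℝ, EP) z),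
    solder z v = 0 ↔ mfderiv 𝓘(ℝ, EP) 𝓘(ℝ, EM) proj z v = 0
  solder_surjective : ∀ z : P, Function.Surjective (solder z)

variable {EG EP EM G P M}
variable {p q : ℕ}

/-- The value at `z = z · 1` of the fundamental vector field associated with the element `h` of the
Lie algebra of `G`. -/
def SmoothPrincipalBundle.fundamentalVector (Q : SmoothPrincipalBundle EG EP EM G P M) (z : P)
    (h : TangentSpace 𝓘(ℝ, EG) (1 : G)) : TangentSpace 𝓘(ℝ, EP) (Q.act z 1) :=
  mfderiv 𝓘(ℝ, EG) 𝓘(ℝ, EP) (fun g ↦ Q.act z g) 1 h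

/-- A connection one-form: a smooth `𝔰𝔬(p, q)`-valued one-form which is equivariant and normalised
on the fundamental vector fields. -/
structure ConnectionForm (Q : OrthonormalFrameBundle EG EP EM G P M p q) where
  /-- The one-form. -/
  form : Π z : P, TangentSpace 𝓘(ℝ, EP) z →L[ℝ] (Rpq p q →L[ℝ] Rpq p q)
  smooth : IsSmoothOneForm form
  skew : ∀ (z : P) (v : TangentSpace 𝓘(ℝ, EP) z), IsSkewEta (form z v)
  equivariant : ∀ (z : P) (g : G) (v : TangentSpace 𝓘(ℝ, EP) z),
    form (Q.act z g) (mfderiv 𝓘(ℝ, EP) 𝓘(ℝ, EP) (fun y ↦ Q.act y g) z v)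
      = Q.rep g⁻¹ ∘L form z v ∘L Q.rep g
  normalized : ∀ (z : P) (h : TangentSpace 𝓘(ℝ, EG) (1 : G)),
    form (Q.act z 1) (Q.fundamentalVector z h) = mvfderiv 𝓘(ℝ, EG) Q.rep 1 h

namespace ConnectionForm

variable {Q : OrthonormalFrameBundle EG EP EM G P M p q} (conn : ConnectionForm Q)

theorem exists_horizontal (z : P) (a : Rpq p q) :
    ∃ v : TangentSpace 𝓘(ℝ, EP) z, conn.form z v = 0 ∧ Q.solder z v = a := by
  suffices H : ∃ v : TangentSpace 𝓘(ℝ, EP) (Q.act z 1),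
      conn.form (Q.act z 1) v = 0 ∧ Q.solder (Q.act z 1) v = a by
    rwa [Q.act_one z] at H
  obtain ⟨v, hv⟩ := Q.solder_surjective (Q.act z 1) a
  obtain ⟨h, -, hh⟩ := Q.rep_lie.surjOn (conn.skew (Q.act z 1) v)
  refine ⟨v - Q.fundamentalVector z h, ?_, ?_⟩
  · rw [map_sub, conn.normalized, hh, sub_self]
  · have h0 : Q.solder (Q.act z 1) (Q.fundamentalVector z h) = 0 := by
      rw [Q.solder_eq_zero_iff]
      have hact : MDifferentiableAt 𝓘(ℝ, EG) 𝓘(ℝ, EP) (fun g ↦ Q.act z g) 1 :=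
        (Q.smooth_act.comp (contMDiff_const.prodMk contMDiff_id)).mdifferentiable (by simp) 1
      have hproj : MDifferentiableAt 𝓘(ℝ, EP) 𝓘(ℝ, EM) Q.proj (Q.act z 1) :=
        Q.smooth_proj.mdifferentiable (by simp) _
      have hc := mfderiv_comp_apply (1 : G) hproj hact h
      have hconst : Q.proj ∘ (fun g ↦ Q.act z g) = fun _ ↦ Q.proj z :=
        funext fun g ↦ Q.proj_act z g
      rw [SmoothPrincipalBundle.fundamentalVector, ← hc, hconst, mfderiv_const]
      rfl
    rw [map_sub, hv, h0, sub_zero]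

/-- The horizontal vector field `u_a` on `P` associated with `a : ℝ^{p,q}`: it is characterised by
`ω(u_a) = 0` and `α(u_a) = a`. -/
def hor (a : Rpq p q) (z : P) : TangentSpace 𝓘(ℝ, EP) z :=
  (conn.exists_horizontal z a).choose

/-- The torsion form `Θ = dα + ω · α`. -/
def torsionForm (z : P) (v w : TangentSpace 𝓘(ℝ, EP) z) : Rpq p q :=
  extDerivOneForm (fun y v ↦ Q.solder y v) z v w
    + (conn.form z v (Q.solder z w) - conn.form z w (Q.solder z v))

/-- The curvature form `Ω = dω + ½ [ω ∧ ω]`, as a form with values in the endomorphisms of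
`ℝ^{p,q}`. -/
def curvatureForm (z : P) (v w : TangentSpace 𝓘(ℝ, EP) z) : Rpq p q →L[ℝ] Rpq p q :=
  extDerivOneForm (fun y v ↦ conn.form y v) z v w
    + (conn.form z v ∘L conn.form z w - conn.form z w ∘L conn.form z v)

/-- The Ricci curvature form `Ric(v)_b = Ω(u_a, v)^a_b`. -/
def ricciForm (z : P) (v : TangentSpace 𝓘(ℝ, EP) z) (b : Fin p ⊕ Fin q) : ℝ :=
  ∑ a, conn.curvatureForm z (conn.hor (stdVec p q a) z) v (stdVec p q b) a

/-- The components `R̂ic_{ab} = Ric(u_a)_b`. -/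
def ricciHat (z : P) (a b : Fin p ⊕ Fin q) : ℝ :=
  conn.ricciForm z (conn.hor (stdVec p q a) z) b

/-- The trace of the torsion, the one-form `tr Θ(v) = Θ(u_a, v)^a`. -/
def trTorsionForm (z : P) (v : TangentSpace 𝓘(ℝ, EP) z) : ℝ :=
  ∑ a, conn.torsionForm z (conn.hor (stdVec p q a) z) v a

/-- The equivariant function `Θ̂` on `P`, with values in the `ℝ^{p,q}`-valued bilinear forms on
`ℝ^{p,q}`: `Θ̂(a, b) = Θ(u_a, u_b)`. -/
def torsionHat (z : P) (a b : Rpq p q) : Rpq p q :=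
  conn.torsionForm z (conn.hor a z) (conn.hor b z)

/-- The covariant differential `d^ω Θ̂ = dΘ̂ + ω · Θ̂`, where `𝔰𝔬(p, q)` acts on the bilinear maps
`A` by `(h · A)(a, b) = h A(a, b) - A(h a, b) - A(a, h b)`. -/
def covDiffTorsionHat (z : P) (v : TangentSpace 𝓘(ℝ, EP) z) (a b : Rpq p q) : Rpq p q :=
  mvfderiv 𝓘(ℝ, EP) (fun y ↦ conn.torsionHat y a b) z v
    + (conn.form z v (conn.torsionHat z a b) - conn.torsionHat z (conn.form z v a) b
      - conn.torsionHat z a (conn.form z v b))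

/-- The covariant divergence `tr (d^ω Θ̂)_{ab} = ((d^ω Θ̂)(u_c))^c_{ab}`. -/
def divTorsionHat (z : P) (a b : Fin p ⊕ Fin q) : ℝ :=
  ∑ c, conn.covDiffTorsionHat z (conn.hor (stdVec p q c) z) (stdVec p q a) (stdVec p q b) c

/-- The components `d(tr Θ)_{ab} = d(tr Θ)(u_a, u_b)`. -/
def extDerivTrTorsionHat (z : P) (a b : Fin p ⊕ Fin q) : ℝ :=
  extDerivOneForm conn.trTorsionForm z (conn.hor (stdVec p q a) z) (conn.hor (stdVec p q b) z)

end ConnectionForm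

end FrameBundle

end

/-! Both parts contract the first Bianchi identity over the derivative slot. Two facts make the
contraction collapse. A metric connection has curvature operators `R(v, w)` skew for a nondegenerate
form, hence of trace zero, and terms quadratic in the connection or the torsion cancel because `tr
(AB) = tr (BA)`.

On the base, tangent vectors at `x` are extended with constant coordinates in the chart at `x`, so
the extensions commute. Curvature, `∇T` and `d (tr T)` then all become combinations of the iterated
derivatives `∇_u ∇_V W` and of products of first derivatives. The traces over `u` and over `V` match
directly. The trace over `W` leaves `tr R(v, w)`, which vanishes by `trace_covCovRight_comm`.

On the frame bundle, the fields `u_a` satisfy `α([u_a, u_b]) = -Θ̂(a, b)` and `ω([u_a, u_b]) =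
-Ω(u_a, u_b)`. Applying `α` to the Jacobi identity for `u_a, u_b, u_c` gives the first Bianchi
identity (`bianchi`), provided that `Θ(u_c, ·)` on the non-horizontal vector `[u_a, u_b]` depends
only on its `α`-part. This is horizontality of `Θ` (`torsionForm_eq_zero`), which follows by
differentiating the equivariance of `α` along the orbits. Smoothness of `u_a`, needed for the
brackets, comes from the injectivity of `(ω, α)`. -/

noncomputable section

set_option linter.unusedSectionVars false

/-! ### Coordinate extensions and the exterior derivative of one-forms -/

section LocalTools

variable {E : Type*} [NormedAddCommGroup E] [NormedSpace ℝ E]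
  {N : Type*} [TopologicalSpace N] [ChartedSpace E N] [IsManifold 𝓘(ℝ, E) ∞ N]
  {W : Type*} [NormedAddCommGroup W] [NormedSpace ℝ W]

theorem extend_eq_symmL {x y : N} (hy : y ∈ (chartAt E x).source)
    (v : TangentSpace 𝓘(ℝ, E) x) :
    extend E v y = (trivializationAt E (TangentSpace 𝓘(ℝ, E)) x).symmL ℝ y v := by
  have h : ((trivializationAt E (TangentSpace 𝓘(ℝ, E)) x) ⟨x, v⟩).2 = v :=
    (tangentBundleCore 𝓘(ℝ, E) N).coordChange_self (achart E x) x (mem_chart_source E x) v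
  simp only [extend, h]
  exact (Trivialization.symmL_apply _ hy _).symm

theorem extend_add {x y : N} (hy : y ∈ (chartAt E x).source) (v w : TangentSpace 𝓘(ℝ, E) x) :
    extend E (v + w) y = extend E v y + extend E w y := by
  simp only [extend_eq_symmL hy]
  exact map_add _ _ _

theorem extend_smul {x y : N} (hy : y ∈ (chartAt E x).source) (c : ℝ)
    (v : TangentSpace 𝓘(ℝ, E) x) :
    extend E (c • v) y = c • extend E v y := by
  simp only [extend_eq_symmL hy]
  exact map_smul _ _ _

theorem extend_eq_mfderivWithin_symm {x y : N} (hy : y ∈ (chartAt E x).source)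
    (v : TangentSpace 𝓘(ℝ, E) x) :
    extend E v y = mfderivWithin 𝓘(ℝ, E) 𝓘(ℝ, E) (extChartAt 𝓘(ℝ, E) x).symm
      (Set.range 𝓘(ℝ, E)) (extChartAt 𝓘(ℝ, E) x y) v := by
  rw [extend_eq_symmL hy, TangentBundle.symmL_trivializationAt hy]
  rfl

theorem mfderiv_extChartAt_extend {x y : N} (hy : y ∈ (chartAt E x).source)
    (v : TangentSpace 𝓘(ℝ, E) x) :
    mfderiv 𝓘(ℝ, E) 𝓘(ℝ, E) (extChartAt 𝓘(ℝ, E) x) y (extend E v y) = v := by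
  rw [extend_eq_mfderivWithin_symm hy]
  exact congrArg (fun f : E →L[ℝ] E ↦ f v)
    (mfderiv_extChartAt_comp_mfderivWithin_extChartAt_symm' (I := 𝓘(ℝ, E)) (x := x) (y := y)
      (by simpa using hy))

/-- A constant vector field on a normed space. -/
def constField (v : E) : Π z : E, TangentSpace 𝓘(ℝ, E) z := fun _ ↦ v

theorem lieBracketWithin_constField (v w p : E) :
    lieBracketWithin ℝ (constField v) (constField w) Set.univ p = (0 : E) := by
  change fderivWithin ℝ (fun _ : E ↦ w) Set.univ p v
      - fderivWithin ℝ (fun _ : E ↦ v) Set.univ p w = (0 : E)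
  simp

theorem extend_eq_mpullback {x y : N} (hy : y ∈ (chartAt E x).source)
    (v : TangentSpace 𝓘(ℝ, E) x) :
    extend E v y = mpullback 𝓘(ℝ, E) 𝓘(ℝ, E) (extChartAt 𝓘(ℝ, E) x) (constField v) y := by
  obtain ⟨e, he⟩ := isInvertible_mfderiv_extChartAt (I := 𝓘(ℝ, E)) (x := x) (y := y)
    (by simpa using hy)
  have h2 := mfderiv_extChartAt_extend hy v
  rw [mpullback_apply, ← he, ContinuousLinearMap.inverse_equiv]
  rw [← he] at h2
  exact (e.symm_apply_eq.2 h2.symm).symm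

/-- The extensions are pullbacks of constant fields by the chart, and pullback commutes with
brackets. This removes every bracket term from curvature, torsion and `d`. -/
theorem mlieBracket_extend_extend [CompleteSpace E] {x y : N} (hy : y ∈ (chartAt E x).source)
    (v w : TangentSpace 𝓘(ℝ, E) x) :
    mlieBracket 𝓘(ℝ, E) (extend E v) (extend E w) y = 0 := by
  have hs : (chartAt E x).source ∈ 𝓝 y := (chartAt E x).open_source.mem_nhds hy
  have hc (u : E) : MDifferentiableAt 𝓘(ℝ, E) 𝓘(ℝ, E).tangent
      (T% (constField u)) (extChartAt 𝓘(ℝ, E) x y) :=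
    (contMDiffAt_vectorSpace_iff_contDiffAt.2 contDiffAt_const).mdifferentiableAt one_ne_zero
  have e (u : TangentSpace 𝓘(ℝ, E) x) : ∀ᶠ z in 𝓝 y, (extend E u) z =
      mpullback 𝓘(ℝ, E) 𝓘(ℝ, E) (extChartAt 𝓘(ℝ, E) x) (constField u) z := by
    filter_upwards [hs] with z hz using extend_eq_mpullback hz u
  have : IsManifold 𝓘(ℝ, E) (minSmoothness ℝ 2) N := by
    rw [minSmoothness_of_isRCLikeNormedField]; infer_instance
  have : IsManifold 𝓘(ℝ, E) (minSmoothness ℝ 2) E := by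
    rw [minSmoothness_of_isRCLikeNormedField]; infer_instance
  rw [Filter.EventuallyEq.mlieBracket_vectorField_eq (e v) (e w),
    ← mpullback_mlieBracket (n := 2) (hc v) (hc w) (contMDiffAt_extChartAt' hy) (by simp),
    mpullback_apply, ← mlieBracketWithin_univ, mlieBracketWithin_eq_lieBracketWithin]
  exact (congrArg _ (lieBracketWithin_constField _ _ _)).trans (map_zero _)

theorem mvfderiv_extend {x y : N} (hy : y ∈ (chartAt E x).source) {f : N → W}
    (hf : MDifferentiableAt 𝓘(ℝ, E) 𝓘(ℝ, W) f y) (v : TangentSpace 𝓘(ℝ, E) x) :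
    mvfderiv 𝓘(ℝ, E) f y (extend E v y)
      = fderiv ℝ (f ∘ (extChartAt 𝓘(ℝ, E) x).symm) (extChartAt 𝓘(ℝ, E) x y) (v : E) := by
  have hy' : y ∈ (extChartAt 𝓘(ℝ, E) x).source := by simpa using hy
  have h1 : (extChartAt 𝓘(ℝ, E) x).symm (extChartAt 𝓘(ℝ, E) x y) = y :=
    (extChartAt 𝓘(ℝ, E) x).left_inv hy'
  have h2 : MDifferentiableAt 𝓘(ℝ, E) 𝓘(ℝ, E) (extChartAt 𝓘(ℝ, E) x).symm
      (extChartAt 𝓘(ℝ, E) x y) := by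
    rw [← mdifferentiableWithinAt_univ]
    simpa using mdifferentiableWithinAt_extChartAt_symm (I := 𝓘(ℝ, E))
      ((extChartAt 𝓘(ℝ, E) x).map_source hy')
  have h3 := mfderiv_comp_apply_of_eq (extChartAt 𝓘(ℝ, E) x y) hf h2 h1 v
  rw [mfderiv_eq_fderiv] at h3
  rw [extend_eq_mfderivWithin_symm hy]
  simp only [modelWithCornersSelf_coe, Set.range_id, mfderivWithin_univ]
  exact h3.symm

theorem mvfderiv_eq_fderiv {x : N} {f : N → W}
    (hf : MDifferentiableAt 𝓘(ℝ, E) 𝓘(ℝ, W) f x) (v : TangentSpace 𝓘(ℝ, E) x) :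
    mvfderiv 𝓘(ℝ, E) f x v
      = fderiv ℝ (f ∘ (extChartAt 𝓘(ℝ, E) x).symm) (extChartAt 𝓘(ℝ, E) x x) (v : E) := by
  have := mvfderiv_extend (mem_chart_source E x) hf v
  rwa [extend_apply_self] at this

theorem contMDiffAt_extend_tangent (x : N) (v : TangentSpace 𝓘(ℝ, E) x) :
    ContMDiffAt 𝓘(ℝ, E) 𝓘(ℝ, E).tangent ∞ (T% (extend E v)) x :=
  contMDiffAt_extend ..

theorem Filter.EventuallyEq.mvfderiv_apply_eq {x : N} {f g : N → W} (h : f =ᶠ[𝓝 x] g)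
    (v : TangentSpace 𝓘(ℝ, E) x) : mvfderiv 𝓘(ℝ, E) f x v = mvfderiv 𝓘(ℝ, E) g x v := by
  have h1 := h.mfderiv_eq (I := 𝓘(ℝ, E)) (I' := 𝓘(ℝ, W))
  exact congrArg (fun L : E →L[ℝ] W ↦ L v) h1

theorem two_le_infty : (2 : WithTop ℕ∞) ≤ ∞ :=
  WithTop.coe_le_coe.2 le_top

theorem ContMDiffAt.contDiffAt_comp_extChartAt_symm {x : N} {f : N → W} {n : WithTop ℕ∞}
    (hn : n ≤ ∞) (hf : ContMDiffAt 𝓘(ℝ, E) 𝓘(ℝ, W) n f x) :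
    ContDiffAt ℝ n (f ∘ (extChartAt 𝓘(ℝ, E) x).symm) (extChartAt 𝓘(ℝ, E) x x) := by
  rw [← contMDiffAt_iff_contDiffAt]
  have h : ContMDiffAt 𝓘(ℝ, E) 𝓘(ℝ, E) ∞ (extChartAt 𝓘(ℝ, E) x).symm (extChartAt 𝓘(ℝ, E) x x) :=
    (contMDiffOn_extChartAt_symm x).contMDiffAt (extChartAt_target_mem_nhds x)
  refine ContMDiffAt.comp _ ?_ (h.of_le hn)
  rwa [extChartAt_to_inv]

theorem ContMDiffAt.eventually_mdifferentiableAt {x : N} {f : N → W}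
    (hf : ContMDiffAt 𝓘(ℝ, E) 𝓘(ℝ, W) 2 f x) :
    ∀ᶠ y in 𝓝 x, MDifferentiableAt 𝓘(ℝ, E) 𝓘(ℝ, W) f y := by
  have h := (contMDiffAt_iff_contMDiffAt_nhds (by simp)).1 hf
  filter_upwards [h] with y hy using hy.mdifferentiableAt (by simp)

theorem mvfderiv_clm_comp_extChartAt {x : N} {g : E → E →L[ℝ] W}
    (hg : DifferentiableAt ℝ g (extChartAt 𝓘(ℝ, E) x x)) (v w : E) :
    mvfderiv 𝓘(ℝ, E) (fun y ↦ g (extChartAt 𝓘(ℝ, E) x y) w) x v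
      = fderiv ℝ g (extChartAt 𝓘(ℝ, E) x x) v w := by
  have hd : DifferentiableAt ℝ (fun p ↦ g p w) (extChartAt 𝓘(ℝ, E) x x) :=
    hg.clm_apply (differentiableAt_const _)
  have h3 := mfderiv_comp_apply (I' := 𝓘(ℝ, E)) x hd.mdifferentiableAt
      (mdifferentiableAt_extChartAt (I := 𝓘(ℝ, E)) (mem_chart_source E x)) v
  rw [mfderiv_extChartAt_self, mfderiv_eq_fderiv] at h3
  refine h3.trans ?_
  rw [fderiv_clm_apply hg (differentiableAt_const _)]
  simp only [fderiv_fun_const, Pi.zero_apply, ContinuousLinearMap.comp_zero, zero_add]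
  rfl

theorem mvfderiv_mvfderiv_extend {x : N} {f : N → W}
    (hf : ContMDiffAt 𝓘(ℝ, E) 𝓘(ℝ, W) 2 f x) (v w : TangentSpace 𝓘(ℝ, E) x) :
    mvfderiv 𝓘(ℝ, E) (fun y ↦ mvfderiv 𝓘(ℝ, E) f y (extend E w y)) x v
      = fderiv ℝ (fderiv ℝ (f ∘ (extChartAt 𝓘(ℝ, E) x).symm)) (extChartAt 𝓘(ℝ, E) x x)
        (v : E) (w : E) := by
  have hgd := ((hf.contDiffAt_comp_extChartAt_symm two_le_infty).fderiv_right
    (m := 1) (by norm_num)).differentiableAt (by simp)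
  refine Eq.trans ?_ (mvfderiv_clm_comp_extChartAt hgd v w)
  refine Filter.EventuallyEq.mvfderiv_apply_eq ?_ v
  filter_upwards [chart_source_mem_nhds E x, hf.eventually_mdifferentiableAt] with y hy hfy
    using mvfderiv_extend hy hfy w

/-- Derivatives along the coordinate extensions of two tangent vectors commute. -/
theorem mvfderiv_mvfderiv_extend_comm {x : N} {f : N → W}
    (hf : ContMDiffAt 𝓘(ℝ, E) 𝓘(ℝ, W) 2 f x) (v w : TangentSpace 𝓘(ℝ, E) x) :
    mvfderiv 𝓘(ℝ, E) (fun y ↦ mvfderiv 𝓘(ℝ, E) f y (extend E w y)) x v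
      = mvfderiv 𝓘(ℝ, E) (fun y ↦ mvfderiv 𝓘(ℝ, E) f y (extend E v y)) x w := by
  have hgs := hf.contDiffAt_comp_extChartAt_symm two_le_infty
  rw [mvfderiv_mvfderiv_extend hf, mvfderiv_mvfderiv_extend hf]
  exact (hgs.isSymmSndFDerivAt (by simp)).eq _ _

/-- With `f i` the image of the `i`-th basis vector under an endomorphism read in coordinates, this
differentiates a trace. -/
theorem mvfderiv_sum_repr {ι : Type*} [FiniteDimensional ℝ W] (b : Module.Basis ι ℝ W)
    (s : Finset ι) {x : N}
    {f : ι → N → W} (hf : ∀ i, MDifferentiableAt 𝓘(ℝ, E) 𝓘(ℝ, W) (f i) x)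
    (v : TangentSpace 𝓘(ℝ, E) x) :
    MDifferentiableAt 𝓘(ℝ, E) 𝓘(ℝ, ℝ) (fun y ↦ ∑ i ∈ s, b.repr (f i y) i) x ∧
    mvfderiv 𝓘(ℝ, E) (fun y ↦ ∑ i ∈ s, b.repr (f i y) i) x v
      = ∑ i ∈ s, b.repr (mvfderiv 𝓘(ℝ, E) (f i) x v) i := by
  classical
  induction s using Finset.induction_on with
  | empty =>
    simp only [Finset.sum_empty]
    exact ⟨mdifferentiableAt_const, by rw [mvfderiv_const]; rfl⟩
  | insert i s hi ih =>
    have hd : MDifferentiableAt 𝓘(ℝ, E) 𝓘(ℝ, ℝ) (fun y ↦ b.repr (f i y) i) x :=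
      (LinearMap.toContinuousLinearMap (b.coord i)).mdifferentiableAt.comp x (hf i)
    have hd' : mvfderiv 𝓘(ℝ, E) (fun y ↦ b.repr (f i y) i) x v
        = b.repr (mvfderiv 𝓘(ℝ, E) (f i) x v) i := by
      have h := mfderiv_comp_apply x
        (LinearMap.toContinuousLinearMap (b.coord i)).mdifferentiableAt (hf i) v
      rw [ContinuousLinearMap.mfderiv_eq] at h
      exact h
    simp only [Finset.sum_insert hi]
    refine ⟨hd.add ih.1, ?_⟩
    have h := mvfderiv_add hd ih.1
    refine (congrArg (fun L : TangentSpace 𝓘(ℝ, E) x →L[ℝ] ℝ ↦ L v) h).trans ?_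
    rw [add_apply, hd', ih.2]

/-- Only `σ x 0 = 0` is required, so that forms given as bare functions, such as `trTorsion`, are
covered. -/
theorem extDerivOneForm_eq_sub [CompleteSpace E]
    (σ : Π x : N, TangentSpace 𝓘(ℝ, E) x → W) (x : N) (hσ : σ x 0 = 0)
    (v w : TangentSpace 𝓘(ℝ, E) x) :
    extDerivOneForm σ x v w = mvfderiv 𝓘(ℝ, E) (fun y ↦ σ y (extend E w y)) x v
      - mvfderiv 𝓘(ℝ, E) (fun y ↦ σ y (extend E v y)) x w := by
  simp only [extDerivOneForm]
  rw [mlieBracket_extend_extend (mem_chart_source E x), hσ, sub_zero]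

/-- A one-form is differentiable at `x` if its values on vector fields which are differentiable
at `x` are differentiable at `x`. -/
def OneFormMDifferentiableAt (σ : Π x : N, TangentSpace 𝓘(ℝ, E) x →L[ℝ] W) (x : N) : Prop :=
  ∀ {X : Π x : N, TangentSpace 𝓘(ℝ, E) x}, MDiffAt (T% X) x →
    MDifferentiableAt 𝓘(ℝ, E) 𝓘(ℝ, W) (fun y ↦ σ y (X y)) x

/-- The invariant formula for the exterior derivative of a one-form. -/
theorem extDerivOneForm_eq [FiniteDimensional ℝ E]
    {σ : Π x : N, TangentSpace 𝓘(ℝ, E) x →L[ℝ] W} {x : N} (hσ : OneFormMDifferentiableAt σ x)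
    {X Y : Π x : N, TangentSpace 𝓘(ℝ, E) x} (hX : MDiffAt (T% X) x) (hY : MDiffAt (T% Y) x) :
    extDerivOneForm (fun y v ↦ σ y v) x (X x) (Y x)
      = mvfderiv 𝓘(ℝ, E) (fun y ↦ σ y (Y y)) x (X x)
        - mvfderiv 𝓘(ℝ, E) (fun y ↦ σ y (X y)) x (Y x)
        - σ x (mlieBracket 𝓘(ℝ, E) X Y x) := by
  have : CompleteSpace E := FiniteDimensional.complete ℝ E
  let Φ : (Π x : N, TangentSpace 𝓘(ℝ, E) x) → (Π x : N, TangentSpace 𝓘(ℝ, E) x) → W :=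
    fun X Y ↦ mvfderiv 𝓘(ℝ, E) (fun y ↦ σ y (Y y)) x (X x)
        - mvfderiv 𝓘(ℝ, E) (fun y ↦ σ y (X y)) x (Y x)
        - σ x (mlieBracket 𝓘(ℝ, E) X Y x)
  -- Antisymmetry transfers tensoriality from the first slot to the second.
  have hswap (X Y) : Φ X Y = - Φ Y X := by
    simp only [Φ]
    rw [mlieBracket_swap_apply, map_neg]
    abel
  have ht (Y : Π x : N, TangentSpace 𝓘(ℝ, E) x) (hY : MDiffAt (T% Y) x) :
      TensorialAt 𝓘(ℝ, E) E (Φ · Y) x := by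
    constructor
    · intro f X hf hX
      have e : (fun y ↦ σ y ((f • X) y)) = f • fun y ↦ σ y (X y) := by
        ext y
        simp
      simp only [Φ]
      rw [e, mvfderiv_smul hf (hσ hX), mlieBracket_smul_left hf hX]
      simp
      module
    · intro X X' hX hX'
      have e : (fun y ↦ σ y ((X + X') y)) = (fun y ↦ σ y (X y)) + fun y ↦ σ y (X' y) := by
        ext y
        simp
      simp only [Φ]
      rw [e, mvfderiv_add (hσ hX) (hσ hX'), mlieBracket_add_left hX hX']
      simp
      abel
  have ht' (X : Π x : N, TangentSpace 𝓘(ℝ, E) x) (hX : MDiffAt (T% X) x) :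
      TensorialAt 𝓘(ℝ, E) E (Φ X ·) x := by
    simp only [hswap X]
    constructor
    · intro f Y hf hY
      rw [(ht X hX).smul hf hY, smul_neg]
    · intro Y Y' hY hY'
      rw [(ht X hX).add hY hY', neg_add]
  -- The definition is `Φ` on the coordinate extensions of `X x` and `Y x`; tensoriality in both
  -- slots allows `X` and `Y` themselves in their place.
  have h := TensorialAt.pointwise₂ ht ht' (mdifferentiableAt_extend 𝓘(ℝ, E) E (X x)) hX
    (mdifferentiableAt_extend 𝓘(ℝ, E) E (Y x)) hY (extend_apply_self E _) (extend_apply_self E _)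
  simp only [Φ, extend_apply_self] at h
  exact h

theorem IsSmoothOneForm.contMDiffAt_apply {σ : Π x : N, TangentSpace 𝓘(ℝ, E) x →L[ℝ] W}
    (hσ : IsSmoothOneForm σ) {X : Π x : N, TangentSpace 𝓘(ℝ, E) x} {x : N} {n : WithTop ℕ∞}
    (hn : n ≤ ∞) (hX : ContMDiffAt 𝓘(ℝ, E) 𝓘(ℝ, E).tangent n (T% X) x) :
    ContMDiffAt 𝓘(ℝ, E) 𝓘(ℝ, W) n (fun y ↦ σ y (X y)) x := by
  have h := ContMDiffAt.clm_bundle_apply ((hσ x).of_le hn) hX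
  simpa [contMDiffAt_section] using h

theorem IsSmoothOneForm.oneFormMDifferentiableAt
    {σ : Π x : N, TangentSpace 𝓘(ℝ, E) x →L[ℝ] W}
    (hσ : IsSmoothOneForm σ) (x : N) : OneFormMDifferentiableAt σ x := by
  intro X hX
  have h := MDifferentiableAt.clm_bundle_apply ((hσ x).mdifferentiableAt (by simp)) hX
  simpa [mdifferentiableAt_section] using h

end LocalTools

/-! ### Traces -/

section Algebra

variable {V : Type*} [AddCommGroup V] [Module ℝ V] [FiniteDimensional ℝ V]

/-- The form identifies `V` with its dual and conjugates `A` into minus its transpose, so `tr A = -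
tr A`. -/
theorem LinearMap.trace_eq_zero_of_skew (B : V →ₗ[ℝ] V →ₗ[ℝ] ℝ) (hB : ∀ v, (∀ w, B v w = 0) → v = 0)
    (A : V →ₗ[ℝ] V) (hA : ∀ v w, B (A v) w = - B v (A w)) :
    LinearMap.trace ℝ V A = 0 := by
  have hinj : Function.Injective B := by
    rw [injective_iff_map_eq_zero]
    intro v hv
    exact hB v fun w ↦ by rw [hv]; rfl
  let e : V ≃ₗ[ℝ] Module.Dual ℝ V :=
    LinearEquiv.ofInjectiveOfFinrankEq B hinj (Subspace.dual_finrank_eq).symm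
  have h : e.conj A = - Module.Dual.transpose (R := ℝ) A := by
    ext φ w
    obtain ⟨v, rfl⟩ := e.surjective φ
    simp only [LinearEquiv.conj_apply_apply, LinearEquiv.symm_apply_apply]
    exact hA v w
  have h2 : LinearMap.trace ℝ V A = - LinearMap.trace ℝ V A :=
    (LinearMap.trace_conj' A e).symm.trans ((congrArg _ h).trans
      ((map_neg _ _).trans (congrArg Neg.neg (LinearMap.trace_transpose' A))))
  linarith

theorem LinearMap.trace_eq_sum_repr {ι : Type*} [Fintype ι] (b : Module.Basis ι ℝ V)
    (A : V →ₗ[ℝ] V) : LinearMap.trace ℝ V A = ∑ i, b.repr (A (b i)) i := by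
  classical
  rw [LinearMap.trace_eq_matrix_trace ℝ b]
  simp [Matrix.trace, LinearMap.toMatrix_apply]

end Algebra

/-! ### The base manifold: iterated covariant derivatives in coordinate extensions -/

section Connection

variable {E : Type*} [NormedAddCommGroup E] [NormedSpace ℝ E] [FiniteDimensional ℝ E]
  {M : Type*} [TopologicalSpace M] [ChartedSpace E M] [IsManifold 𝓘(ℝ, E) ∞ M]
  (cov : CovariantDerivative 𝓘(ℝ, E) E (TangentSpace 𝓘(ℝ, E) : M → Type _))

theorem eventually_mdifferentiableAt_extend (x : M) (v : TangentSpace 𝓘(ℝ, E) x) :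
    ∀ᶠ y in 𝓝 x, MDiffAt (T% (extend E v)) y := by
  obtain ⟨s, hs, h⟩ := exists_mdifferentiableOn_extend 𝓘(ℝ, E) E v
  filter_upwards [eventually_mem_nhds_iff.2 hs] with y hy using
    (h y (mem_of_mem_nhds hy)).mdifferentiableAt hy

/-- Locality of the connection: the relation between the fields is needed only near `x`. Coordinate
extensions depend linearly on the vector only over the chart domain, so additivity of the connection
alone would not suffice. -/
theorem cov_eq_add {x : M} {X Y Z : Π y : M, TangentSpace 𝓘(ℝ, E) y} (hX : MDiffAt (T% X) x)
    (hY : MDiffAt (T% Y) x) (hZ : MDiffAt (T% Z) x) (h : ∀ᶠ y in 𝓝 x, Z y = X y + Y y) :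
    cov Z x = cov X x + cov Y x := by
  rw [← cov.isCovariantDerivativeOnUniv.add hX hY]
  exact cov.isCovariantDerivativeOnUniv.congr_of_eventuallyEq hZ
    (mdifferentiableAt_add_section hX hY) Filter.univ_mem h

theorem cov_eq_smul {x : M} {X Z : Π y : M, TangentSpace 𝓘(ℝ, E) y} (c : ℝ)
    (hX : MDiffAt (T% X) x) (hZ : MDiffAt (T% Z) x) (h : ∀ᶠ y in 𝓝 x, Z y = c • X y) :
    cov Z x = c • cov X x := by
  rw [← cov.isCovariantDerivativeOnUniv.smul_const c hX]
  exact cov.isCovariantDerivativeOnUniv.congr_of_eventuallyEq hZ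
    (mdifferentiableAt_const.smul_section hX) Filter.univ_mem h

/-- The linear map `u ↦ ∇_v U`, where `U` is the coordinate extension of `u`. -/
def covExtend (x : M) (v : TangentSpace 𝓘(ℝ, E) x) :
    TangentSpace 𝓘(ℝ, E) x →ₗ[ℝ] TangentSpace 𝓘(ℝ, E) x where
  toFun u := cov (extend E u) x v
  map_add' u u' := by
    rw [cov_eq_add cov (mdifferentiableAt_extend ..) (mdifferentiableAt_extend ..)
      (mdifferentiableAt_extend ..) (by
        filter_upwards [chart_source_mem_nhds E x] with y hy using extend_add hy u u')]
    rfl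
  map_smul' c u := by
    rw [cov_eq_smul cov c (mdifferentiableAt_extend ..) (mdifferentiableAt_extend ..) (by
        filter_upwards [chart_source_mem_nhds E x] with y hy using extend_smul hy c u)]
    rfl

variable [T2Space M] [CovariantDerivative.ContMDiffCovariantDerivative cov ∞]

/-- The second covariant derivative `∇_u ∇_V W` at `x`, where `V`, `W` are the coordinate
extensions of `v`, `w`. -/
def covCov (x : M) (u v w : TangentSpace 𝓘(ℝ, E) x) : TangentSpace 𝓘(ℝ, E) x :=
  cov (fun y ↦ cov (extend E w) y (extend E v y)) x u

theorem mdifferentiableAt_cov_extend_extend (x : M) (v w : TangentSpace 𝓘(ℝ, E) x) :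
    MDiffAt (T% (fun y ↦ cov (extend E w) y (extend E v y))) x :=
  mdifferentiableAt_cov_extend_apply cov x w (mdifferentiableAt_extend ..)

/-- `∇_u ∇_V W` as a linear function of `v`. -/
def covCovMiddle (x : M) (u w : TangentSpace 𝓘(ℝ, E) x) :
    TangentSpace 𝓘(ℝ, E) x →ₗ[ℝ] TangentSpace 𝓘(ℝ, E) x where
  toFun v := covCov cov x u v w
  map_add' v v' := by
    simp only [covCov]
    rw [cov_eq_add cov (mdifferentiableAt_cov_extend_extend cov x v w)
      (mdifferentiableAt_cov_extend_extend cov x v' w)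
      (mdifferentiableAt_cov_extend_extend cov x (v + v') w) (by
        filter_upwards [chart_source_mem_nhds E x] with y hy
        rw [extend_add hy, map_add])]
    rfl
  map_smul' c v := by
    simp only [covCov]
    rw [cov_eq_smul cov c (mdifferentiableAt_cov_extend_extend cov x v w)
      (mdifferentiableAt_cov_extend_extend cov x (c • v) w) (by
        filter_upwards [chart_source_mem_nhds E x] with y hy
        rw [extend_smul hy, map_smul])]
    rfl

/-- `∇_u ∇_V W` as a linear function of `w`. -/
def covCovRight (x : M) (u v : TangentSpace 𝓘(ℝ, E) x) :
    TangentSpace 𝓘(ℝ, E) x →ₗ[ℝ] TangentSpace 𝓘(ℝ, E) x where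
  toFun w := covCov cov x u v w
  map_add' w w' := by
    simp only [covCov]
    rw [cov_eq_add cov (mdifferentiableAt_cov_extend_extend cov x v w)
      (mdifferentiableAt_cov_extend_extend cov x v w')
      (mdifferentiableAt_cov_extend_extend cov x v (w + w')) (by
        filter_upwards [eventually_mem_nhds_iff.2 (chart_source_mem_nhds E x),
          eventually_mdifferentiableAt_extend x w, eventually_mdifferentiableAt_extend x w',
          eventually_mdifferentiableAt_extend x (w + w')] with y hy h1 h2 h3
        rw [cov_eq_add cov h1 h2 h3 (by filter_upwards [hy] with z hz using extend_add hz w w')]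
        rfl)]
    rfl
  map_smul' c w := by
    simp only [covCov]
    rw [cov_eq_smul cov c (mdifferentiableAt_cov_extend_extend cov x v w)
      (mdifferentiableAt_cov_extend_extend cov x v (c • w)) (by
        filter_upwards [eventually_mem_nhds_iff.2 (chart_source_mem_nhds E x),
          eventually_mdifferentiableAt_extend x w,
          eventually_mdifferentiableAt_extend x (c • w)] with y hy h1 h2
        rw [cov_eq_smul cov c h1 h2 (by filter_upwards [hy] with z hz using extend_smul hz c w)]
        rfl)]
    rfl

/-- `∇_u ∇_V W` as a linear function of `u`. -/
def covCovLeft (x : M) (v w : TangentSpace 𝓘(ℝ, E) x) :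
    TangentSpace 𝓘(ℝ, E) x →ₗ[ℝ] TangentSpace 𝓘(ℝ, E) x :=
  (cov (fun y ↦ cov (extend E w) y (extend E v y)) x).toLinearMap

variable [CompleteSpace E]

theorem curvatureEnd_apply (x : M) (u v w : TangentSpace 𝓘(ℝ, E) x) :
    curvatureEnd cov x v w u = covCov cov x u v w - covCov cov x v u w := by
  rw [curvatureEnd, TensorialAt.mkHom_apply_eq_extend, curvatureAux,
    mlieBracket_extend_extend (mem_chart_source E x), map_zero, sub_zero, extend_apply_self]
  rfl

theorem torsion_extend_eventuallyEq (x : M) (v w : TangentSpace 𝓘(ℝ, E) x) :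
    ∀ᶠ y in 𝓝 x, cov.torsion y (extend E v y) (extend E w y)
      = cov (extend E w) y (extend E v y) - cov (extend E v) y (extend E w y) := by
  filter_upwards [chart_source_mem_nhds E x, eventually_mdifferentiableAt_extend x v,
    eventually_mdifferentiableAt_extend x w] with y hy hv hw
  rw [cov.torsion_apply hv hw, mlieBracket_extend_extend hy, sub_zero]

theorem torsion_eq_covExtend (x : M) (v w : TangentSpace 𝓘(ℝ, E) x) :
    cov.torsion x v w = covExtend cov x v w - covExtend cov x w v := by
  have h := (torsion_extend_eventuallyEq cov x v w).self_of_nhds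
  simp only [extend_apply_self] at h
  exact h

theorem mdifferentiableAt_torsion_extend (x : M) (v w : TangentSpace 𝓘(ℝ, E) x) :
    MDiffAt (T% (fun y ↦ cov.torsion y (extend E v y) (extend E w y))) x := by
  refine (mdifferentiableAt_sub_section (mdifferentiableAt_cov_extend_extend cov x v w)
    (mdifferentiableAt_cov_extend_extend cov x w v)).congr_of_eventuallyEq ?_
  filter_upwards [torsion_extend_eventuallyEq cov x v w] with y hy
  simp only [hy]
  rfl

theorem cov_torsion_extend (x : M) (u v w : TangentSpace 𝓘(ℝ, E) x) :
    cov (fun y ↦ cov.torsion y (extend E v y) (extend E w y)) x u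
      = covCov cov x u v w - covCov cov x u w v := by
  have h := cov_eq_add cov (mdifferentiableAt_torsion_extend cov x v w)
    (mdifferentiableAt_cov_extend_extend cov x w v)
    (mdifferentiableAt_cov_extend_extend cov x v w) (by
      filter_upwards [torsion_extend_eventuallyEq cov x v w] with y hy
      rw [hy]; abel)
  rw [covCov, covCov, h]
  simp

/-- The coordinates at `y` of a tangent vector in the chart at `x`. -/
def coordAt (x y : M) : TangentSpace 𝓘(ℝ, E) y →L[ℝ] E :=
  (trivializationAt E (TangentSpace 𝓘(ℝ, E)) x).continuousLinearMapAt ℝ y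

theorem coordAt_extend {x y : M} (hy : y ∈ (chartAt E x).source) (v : TangentSpace 𝓘(ℝ, E) x) :
    coordAt x y (extend E v y) = (v : E) := by
  rw [extend_eq_symmL hy]
  exact Trivialization.continuousLinearMapAt_symmL _ hy _

theorem coordAt_self (x : M) (v : TangentSpace 𝓘(ℝ, E) x) : coordAt x x v = (v : E) := by
  have h := coordAt_extend (mem_chart_source E x) v
  rwa [extend_apply_self] at h

theorem mdifferentiableAt_coordAt {x : M} {X : Π y : M, TangentSpace 𝓘(ℝ, E) y}
    (hX : MDiffAt (T% X) x) :
    MDifferentiableAt 𝓘(ℝ, E) 𝓘(ℝ, E) (fun y ↦ coordAt x y (X y)) x := by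
  refine ((mdifferentiableAt_section 𝓘(ℝ, E) X).1 hX).congr_of_eventuallyEq ?_
  filter_upwards [chart_source_mem_nhds E x] with y hy
  exact Trivialization.continuousLinearMapAt_apply_of_mem ℝ _ hy _

/-- The derivative of the coordinates of a vector field. -/
theorem mvfderiv_coordAt {x : M} {X : Π y : M, TangentSpace 𝓘(ℝ, E) y}
    (hX : MDiffAt (T% X) x) (v : TangentSpace 𝓘(ℝ, E) x) :
    mvfderiv 𝓘(ℝ, E) (fun y ↦ coordAt x y (X y)) x v
      = coordAt x x (cov X x v - covExtend cov x v (X x)) := by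
  -- `Φ` compares `∇` with the flat connection of the chart. The Leibniz terms cancel, so `Φ` is
  -- tensorial and may be evaluated on the coordinate extension of `X x`, whose coordinates are
  -- constant.
  let Φ : (Π y : M, TangentSpace 𝓘(ℝ, E) y) → E :=
    fun X ↦ coordAt x x (cov X x v) - mvfderiv 𝓘(ℝ, E) (fun y ↦ coordAt x y (X y)) x v
  have ht : TensorialAt 𝓘(ℝ, E) E Φ x := by
    constructor
    · intro f X hf hX
      have e : (fun y ↦ coordAt x y ((f • X) y)) = f • fun y ↦ coordAt x y (X y) := by
        ext y
        simp
      simp only [Φ]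
      rw [e, mvfderiv_smul hf (mdifferentiableAt_coordAt hX),
        cov.isCovariantDerivativeOnUniv.leibniz hX hf]
      simp
      module
    · intro X X' hX hX'
      have e : (fun y ↦ coordAt x y ((X + X') y))
          = (fun y ↦ coordAt x y (X y)) + fun y ↦ coordAt x y (X' y) := by
        ext y
        simp
      simp only [Φ]
      rw [e, mvfderiv_add (mdifferentiableAt_coordAt hX) (mdifferentiableAt_coordAt hX'),
        cov.isCovariantDerivativeOnUniv.add hX hX']
      simp
      abel
  have h := ht.pointwise hX (mdifferentiableAt_extend 𝓘(ℝ, E) E (X x)) (extend_apply_self E _).symm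
  have h0 : mvfderiv 𝓘(ℝ, E) (fun y ↦ coordAt x y (extend E (X x) y)) x v = 0 := by
    rw [Filter.EventuallyEq.mvfderiv_apply_eq (g := fun _ ↦ coordAt x x (X x)) (by
      filter_upwards [chart_source_mem_nhds E x] with y hy
      rw [coordAt_extend hy, coordAt_self]), mvfderiv_const]
    rfl
  simp only [Φ, h0, sub_zero] at h
  rw [map_sub, sub_eq_iff_eq_add.1 h]
  change _ = _ + _ - coordAt x x (cov (extend E (X x)) x v)
  abel

/-- A vector of the model space as a tangent vector at `x`. -/
def asTangent (x : M) (v : E) : TangentSpace 𝓘(ℝ, E) x := v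

/-- The coordinate frame of one chart computes the trace at every nearby `y` with a fixed basis of
`E`; a trace varying with `y` thus becomes a finite sum that can be differentiated. -/
theorem trace_eq_sum_coordAt {ι : Type*} [Fintype ι] (b : Module.Basis ι ℝ E) {x y : M}
    (hy : y ∈ (chartAt E x).source) (A : TangentSpace 𝓘(ℝ, E) y →ₗ[ℝ] TangentSpace 𝓘(ℝ, E) y) :
    LinearMap.trace ℝ (TangentSpace 𝓘(ℝ, E) y) A
      = ∑ i, b.repr (coordAt x y (A (extend E (asTangent x (b i)) y))) i := by
  let e := (trivializationAt E (TangentSpace 𝓘(ℝ, E)) x).continuousLinearEquivAt ℝ y hy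
  rw [← LinearMap.trace_conj' A e.toLinearEquiv, LinearMap.trace_eq_sum_repr b]
  refine Finset.sum_congr rfl fun i _ ↦ ?_
  have h : e.symm (b i) = extend E (asTangent x (b i)) y := by
    rw [ContinuousLinearEquiv.symm_apply_eq]
    refine (coordAt_extend hy (asTangent x (b i))).symm.trans ?_
    exact Trivialization.continuousLinearMapAt_apply_of_mem ℝ _ hy _
  rw [← h]
  congr 2
  exact (Trivialization.continuousLinearMapAt_apply_of_mem ℝ _ hy _).symm

/-- In the coordinate frame, differentiating components is `∇_v` minus the Christoffel term
`covExtend cov x v`. The `∇_v` part acts on `T(U, W) = ∇_U W - ∇_W U`, where `U` runs over the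
traced slot: this gives the middle trace minus the right trace. -/
theorem mvfderiv_trTorsion_extend (x : M) (v w : TangentSpace 𝓘(ℝ, E) x) :
    mvfderiv 𝓘(ℝ, E) (fun y ↦ trTorsion cov y (extend E w y)) x v
      = LinearMap.trace ℝ _ (covCovMiddle cov x v w) - LinearMap.trace ℝ _ (covCovRight cov x v w)
        - LinearMap.trace ℝ _ (covExtend cov x v ∘ₗ torsionEnd cov x w) := by
  let b := Module.finBasis ℝ E
  have h1 : ∀ᶠ y in 𝓝 x, trTorsion cov y (extend E w y) = ∑ i, b.repr (coordAt x y
      (cov.torsion y (extend E (asTangent x (b i)) y) (extend E w y))) i := by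
    filter_upwards [chart_source_mem_nhds E x] with y hy
    rw [trTorsion, trace_eq_sum_coordAt b hy]
    rfl
  rw [Filter.EventuallyEq.mvfderiv_apply_eq h1, (mvfderiv_sum_repr b _
    (fun i ↦ mdifferentiableAt_coordAt (mdifferentiableAt_torsion_extend cov x _ w)) v).2]
  rw [← LinearMap.map_sub, ← LinearMap.map_sub, trace_eq_sum_coordAt b (mem_chart_source E x)]
  refine Finset.sum_congr rfl fun i _ ↦ ?_
  rw [mvfderiv_coordAt cov (mdifferentiableAt_torsion_extend cov x _ w), cov_torsion_extend]
  simp only [extend_apply_self]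
  rfl

/-! ### Metric compatibility and the trace of the curvature operator -/

theorem PseudoRiemannianMetric.mdifferentiableAt_apply (g : PseudoRiemannianMetric E M) {x : M}
    {X Y : Π y : M, TangentSpace 𝓘(ℝ, E) y} (hX : MDiffAt (T% X) x) (hY : MDiffAt (T% Y) x) :
    MDifferentiableAt 𝓘(ℝ, E) 𝓘(ℝ, ℝ) (fun y ↦ g.val y (X y) (Y y)) x := by
  have h := MDifferentiableAt.clm_bundle_apply₂ ((g.smooth x).mdifferentiableAt (by simp)) hX hY
  simpa [mdifferentiableAt_section] using h

theorem PseudoRiemannianMetric.contMDiffAt_apply (g : PseudoRiemannianMetric E M) {x : M}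
    {X Y : Π y : M, TangentSpace 𝓘(ℝ, E) y}
    (hX : ContMDiffAt 𝓘(ℝ, E) 𝓘(ℝ, E).tangent ∞ (T% X) x)
    (hY : ContMDiffAt 𝓘(ℝ, E) 𝓘(ℝ, E).tangent ∞ (T% Y) x) :
    ContMDiffAt 𝓘(ℝ, E) 𝓘(ℝ, ℝ) ∞ (fun y ↦ g.val y (X y) (Y y)) x := by
  have h := ContMDiffAt.clm_bundle_apply₂ (g.smooth x) hX hY
  simpa [contMDiffAt_section] using h

/-- Compatibility is used twice. The two mixed terms together are symmetric in `v, w`, so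
antisymmetrising leaves only the curvature. -/
theorem PseudoRiemannianMetric.mvfderiv_mvfderiv_apply {g : PseudoRiemannianMetric E M}
    (hg : g.IsCompatible cov) (x : M) (v w a b : TangentSpace 𝓘(ℝ, E) x) :
    mvfderiv 𝓘(ℝ, E) (fun y ↦ mvfderiv 𝓘(ℝ, E) (fun z ↦ g.val z (extend E a z) (extend E b z)) y
      (extend E w y)) x v
      = g.val x (covCov cov x v w a) b + g.val x (covExtend cov x w a) (covExtend cov x v b)
        + (g.val x (covExtend cov x v a) (covExtend cov x w b)
          + g.val x a (covCov cov x v w b)) := by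
  have h1 : ∀ᶠ y in 𝓝 x,
      mvfderiv 𝓘(ℝ, E) (fun z ↦ g.val z (extend E a z) (extend E b z)) y (extend E w y)
        = g.val y (cov (extend E a) y (extend E w y)) (extend E b y)
          + g.val y (extend E a y) (cov (extend E b) y (extend E w y)) := by
    filter_upwards [eventually_mdifferentiableAt_extend x a,
      eventually_mdifferentiableAt_extend x b] with y ha hb
    exact hg y _ _ ha hb _
  have ha := mdifferentiableAt_extend 𝓘(ℝ, E) E a
  have hb := mdifferentiableAt_extend 𝓘(ℝ, E) E b
  have hwa := mdifferentiableAt_cov_extend_extend cov x w a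
  have hwb := mdifferentiableAt_cov_extend_extend cov x w b
  have h2 := mvfderiv_add (g.mdifferentiableAt_apply hwa hb) (g.mdifferentiableAt_apply ha hwb)
  rw [Filter.EventuallyEq.mvfderiv_apply_eq h1]
  refine (congrArg (fun L : TangentSpace 𝓘(ℝ, E) x →L[ℝ] ℝ ↦ L v) h2).trans ?_
  rw [add_apply, hg x _ _ hwa hb, hg x _ _ ha hwb]
  simp only [extend_apply_self]
  rfl

/-- The difference of the two endomorphisms is `R(v, w)`. Second derivatives of `g(A, B)` along
commuting extensions agree, which makes `R(v, w)` skew for `g`, hence traceless. -/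
theorem PseudoRiemannianMetric.trace_covCovRight_comm {g : PseudoRiemannianMetric E M}
    (hg : g.IsCompatible cov) (x : M) (v w : TangentSpace 𝓘(ℝ, E) x) :
    LinearMap.trace ℝ _ (covCovRight cov x v w) = LinearMap.trace ℝ _ (covCovRight cov x w v) := by
  rw [← sub_eq_zero, ← LinearMap.map_sub]
  have : FiniteDimensional ℝ (TangentSpace 𝓘(ℝ, E) x) := inferInstanceAs (FiniteDimensional ℝ E)
  refine LinearMap.trace_eq_zero_of_skew
    ((ContinuousLinearMap.coeLM ℝ) ∘ₗ (g.val x).toLinearMap) (g.nondegenerate x) _ ?_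
  intro a b
  have h := mvfderiv_mvfderiv_extend_comm (x := x)
    ((g.contMDiffAt_apply (contMDiffAt_extend_tangent x a) (contMDiffAt_extend_tangent x b)).of_le
      two_le_infty) v w
  rw [g.mvfderiv_mvfderiv_apply cov hg, g.mvfderiv_mvfderiv_apply cov hg] at h
  change g.val x (covCov cov x v w a - covCov cov x w v a) b
    = - g.val x a (covCov cov x v w b - covCov cov x w v b)
  simp only [map_sub, sub_apply]
  linarith

/-- The contracted Bianchi identity for a metric connection. -/
theorem ricci_sub_ricci {g : PseudoRiemannianMetric E M} (hg : g.IsCompatible cov) (x : M)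
    (v w : TangentSpace 𝓘(ℝ, E) x) :
    ricci cov x v w - ricci cov x w v
      = divTorsion cov x v w - extDerivOneForm (trTorsion cov) x v w := by
  have h0 : trTorsion cov x 0 = 0 := by
    simp only [trTorsion, torsionEnd, map_zero]
  rw [extDerivOneForm_eq_sub _ _ h0, mvfderiv_trTorsion_extend, mvfderiv_trTorsion_extend]
  have : FiniteDimensional ℝ (TangentSpace 𝓘(ℝ, E) x) := inferInstanceAs (FiniteDimensional ℝ E)
  have hA (v w : TangentSpace 𝓘(ℝ, E) x) : (curvatureEnd cov x v w).toLinearMap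
      = (covCovLeft cov x v w) - covCovMiddle cov x v w :=
    LinearMap.ext fun u ↦ curvatureEnd_apply cov x u v w
  have hT (w : TangentSpace 𝓘(ℝ, E) x) : torsionEnd cov x w
      = (cov (extend E w) x).toLinearMap - covExtend cov x w := by
    ext u
    exact torsion_eq_covExtend cov x u w
  have hT' (w : TangentSpace 𝓘(ℝ, E) x) : (cov.torsion x w).toLinearMap
      = covExtend cov x w - (cov (extend E w) x).toLinearMap := by
    ext u
    exact torsion_eq_covExtend cov x w u
  have hD : covDerivTorsion cov x v w = (covCovLeft cov x v w) - (covCovLeft cov x w v)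
    - torsionEnd cov x w ∘ₗ (cov (extend E v) x).toLinearMap
    - (cov.torsion x v).toLinearMap ∘ₗ (cov (extend E w) x).toLinearMap := by
    rw [covDerivTorsion]
    congr 2
    ext u
    exact cov_torsion_extend cov x u v w
  simp only [ricci, divTorsion, hA, hD, hT, hT', map_sub, LinearMap.sub_comp, LinearMap.comp_sub]
  have hm := g.trace_covCovRight_comm cov hg x v w
  have hc (A B : TangentSpace 𝓘(ℝ, E) x →ₗ[ℝ] TangentSpace 𝓘(ℝ, E) x) :
    LinearMap.trace ℝ _ (A ∘ₗ B) = LinearMap.trace ℝ _ (B ∘ₗ A) := LinearMap.trace_comp_comm' _ _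
  -- What is left is quadratic in first derivatives, the torsion having been expanded through `hT`
  -- and `hT'`; cyclicity of the trace cancels it.
  have e1 := hc (covExtend cov x v) (covExtend cov x w)
  have e2 := hc (covExtend cov x v) (cov (extend E w) x).toLinearMap
  have e3 := hc (covExtend cov x w) (cov (extend E v) x).toLinearMap
  have e4 := hc (cov (extend E v) x).toLinearMap (cov (extend E w) x).toLinearMap
  linarith

end Connection

/-! ### Infinitesimal equivariance in a vector space -/

section LieDerivative

variable {E E' W : Type*} [NormedAddCommGroup E] [NormedSpace ℝ E]
  [NormedAddCommGroup E'] [NormedSpace ℝ E'] [NormedAddCommGroup W] [NormedSpace ℝ W]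

/-- The exterior derivative of a one-form `a` which vanishes along the orbits of a family of maps
`F(·, e)` and is equivariant under these maps. -/
theorem fderiv_sub_fderiv_of_equivariant {F : E × E' → E} {p₀ : E} {e₀ : E'}
    (hF : ContDiffAt ℝ 2 F (p₀, e₀)) (hF₀ : F (p₀, e₀) = p₀)
    (hF₁ : ∀ w, fderiv ℝ F (p₀, e₀) (w, 0) = w)
    {a : E → E →L[ℝ] W} (ha : DifferentiableAt ℝ a p₀)
    {r : E' → W →L[ℝ] W} (hr : DifferentiableAt ℝ r e₀) (hr₀ : r e₀ = .id ℝ W) (w : E) (h : E')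
    (h₁ : ∀ᶠ e in 𝓝 e₀, r e (a (F (p₀, e)) (fderiv ℝ F (p₀, e) (w, 0))) = a p₀ w)
    (h₂ : ∀ᶠ p in 𝓝 p₀, a (F (p, e₀)) (fderiv ℝ F (p, e₀) (0, h)) = 0) :
    fderiv ℝ a p₀ (fderiv ℝ F (p₀, e₀) (0, h)) w - fderiv ℝ a p₀ w (fderiv ℝ F (p₀, e₀) (0, h))
      = - fderiv ℝ r e₀ h (a p₀ w) := by
  have hD : HasFDerivAt F (fderiv ℝ F (p₀, e₀)) (p₀, e₀) :=
    (hF.differentiableAt (by simp)).hasFDerivAt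
  have hDD : HasFDerivAt (fderiv ℝ F) (fderiv ℝ (fderiv ℝ F) (p₀, e₀)) (p₀, e₀) :=
    ((hF.fderiv_right (m := 1) (by norm_num)).differentiableAt (by simp)).hasFDerivAt
  have hsymm : fderiv ℝ (fderiv ℝ F) (p₀, e₀) (0, h) (w, 0)
      = fderiv ℝ (fderiv ℝ F) (p₀, e₀) (w, 0) (0, h) :=
    (hF.isSymmSndFDerivAt (by simp)).eq _ _
  have ha' : HasFDerivAt a (fderiv ℝ a p₀) (F (p₀, e₀)) := by rw [hF₀]; exact ha.hasFDerivAt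
  -- This is the derivative of `x ↦ a (F x) (DF x v)`, to be restricted to the slice `p = p₀` for
  -- `h₁` and to the slice `e = e₀` for `h₂`.
  have hpull (v : E × E') := (ha'.comp (p₀, e₀) hD).clm_apply
    (hDD.clm_apply (hasFDerivAt_const v (p₀, e₀)))
  have hi₁ : HasFDerivAt (fun e : E' ↦ (p₀, e)) (ContinuousLinearMap.inr ℝ E E') e₀ :=
    hasFDerivAt_prodMk_right p₀ e₀
  have hi₂ : HasFDerivAt (fun p : E ↦ (p, e₀)) (ContinuousLinearMap.inl ℝ E E') p₀ :=
    hasFDerivAt_prodMk_left p₀ e₀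
  have d₁ := hr.hasFDerivAt.clm_apply (HasFDerivAt.comp e₀ (hpull (w, 0)) hi₁)
  have d₂ := HasFDerivAt.comp p₀ (hpull (0, h)) hi₂
  have e₁ := (d₁.congr_of_eventuallyEq (f₁ := fun _ ↦ a p₀ w)
    (by filter_upwards [h₁] with e he using he.symm)).unique (hasFDerivAt_const _ _)
  have e₂ := (d₂.congr_of_eventuallyEq (f₁ := fun _ ↦ (0 : W))
    (by filter_upwards [h₂] with e he using he.symm)).unique (hasFDerivAt_const _ _)
  have f₁ := congrArg (fun L : E' →L[ℝ] W ↦ L h) e₁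
  have f₂ := congrArg (fun L : E →L[ℝ] W ↦ L w) e₂
  simp [hF₀, hF₁, hr₀] at f₁ f₂
  rw [hsymm] at f₁
  -- Each of `f₁`, `f₂` contains `a p₀` applied to a mixed second derivative of `F`; by `hsymm` the
  -- two cancel in the difference.
  linear_combination (norm := module) f₁ - f₂

end LieDerivative

/-! ### One-forms read in charts -/

section ChartForm

variable {E : Type*} [NormedAddCommGroup E] [NormedSpace ℝ E]
  {N : Type*} [TopologicalSpace N] [ChartedSpace E N] [IsManifold 𝓘(ℝ, E) ∞ N]
  {E' : Type*} [NormedAddCommGroup E'] [NormedSpace ℝ E']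
  {N' : Type*} [TopologicalSpace N'] [ChartedSpace E' N'] [IsManifold 𝓘(ℝ, E') ∞ N']
  {W : Type*} [NormedAddCommGroup W] [NormedSpace ℝ W]

/-- The value at `y` of a one-form, expressed in the coordinates of the chart at `x`. -/
def coordForm (σ : Π x : N, TangentSpace 𝓘(ℝ, E) x →L[ℝ] W) (x y : N) : E →L[ℝ] W :=
  σ y ∘L (trivializationAt E (TangentSpace 𝓘(ℝ, E)) x).symmL ℝ y

variable {σ : Π x : N, TangentSpace 𝓘(ℝ, E) x →L[ℝ] W}

theorem coordForm_apply {x y : N} (hy : y ∈ (chartAt E x).source) (v : TangentSpace 𝓘(ℝ, E) x) :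
    coordForm σ x y v = σ y (extend E v y) := by
  rw [extend_eq_symmL hy]
  rfl

theorem coordForm_self (x : N) (v : TangentSpace 𝓘(ℝ, E) x) : coordForm σ x x v = σ x v := by
  rw [coordForm_apply (mem_chart_source E x), extend_apply_self]

theorem IsSmoothOneForm.contMDiffAt_coordForm (hσ : IsSmoothOneForm σ) (x : N) :
    ContMDiffAt 𝓘(ℝ, E) 𝓘(ℝ, E →L[ℝ] W) ∞ (coordForm σ x) x := by
  have h := (contMDiffAt_hom_bundle _).1 (hσ x)
  refine h.2.congr_of_eventuallyEq ?_
  filter_upwards with y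
  simp only [ContinuousLinearMap.inCoordinates]
  ext v
  simp [coordForm]

theorem mfderiv_eq_extend_mfderiv {x y : N} (hy : y ∈ (chartAt E x).source)
    (v : TangentSpace 𝓘(ℝ, E) y) :
    extend E (asTangent (E := E) x (mfderiv 𝓘(ℝ, E) 𝓘(ℝ, E) (extChartAt 𝓘(ℝ, E) x) y v)) y = v := by
  obtain ⟨e, he⟩ := isInvertible_mfderiv_extChartAt (I := 𝓘(ℝ, E)) (x := x) (y := y)
    (by simpa using hy)
  have h := mfderiv_extChartAt_extend hy
    (asTangent (E := E) x (mfderiv 𝓘(ℝ, E) 𝓘(ℝ, E) (extChartAt 𝓘(ℝ, E) x) y v))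
  rw [← he] at h ⊢
  exact e.injective h

/-- The pullback of a one-form, computed in charts. -/
theorem coordForm_fderiv {f : N' → N} {x : N} {x' y : N'} (hy : y ∈ (chartAt E' x').source)
    (hfy : f y ∈ (chartAt E x).source) (hf : MDifferentiableAt 𝓘(ℝ, E') 𝓘(ℝ, E) f y)
    (v : TangentSpace 𝓘(ℝ, E') x') :
    coordForm σ x (f y) (fderiv ℝ (extChartAt 𝓘(ℝ, E) x ∘ f ∘ (extChartAt 𝓘(ℝ, E') x').symm)
      (extChartAt 𝓘(ℝ, E') x' y) v) = σ (f y) (mfderiv 𝓘(ℝ, E') 𝓘(ℝ, E) f y (extend E' v y)) := by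
  have hφ : MDifferentiableAt 𝓘(ℝ, E) 𝓘(ℝ, E) (extChartAt 𝓘(ℝ, E) x) (f y) :=
    mdifferentiableAt_extChartAt hfy
  have h1 := mvfderiv_extend hy (f := extChartAt 𝓘(ℝ, E) x ∘ f) (hφ.comp y hf) v
  have h2 := mfderiv_comp_apply y hφ hf (extend E' v y)
  refine (congrArg (coordForm σ x (f y)) (h1.symm.trans h2)).trans ?_
  refine (coordForm_apply hfy (asTangent (E := E) x _)).trans ?_
  exact congrArg (σ (f y)) (mfderiv_eq_extend_mfderiv hfy _)

theorem mvfderiv_apply_extend (hσ : IsSmoothOneForm σ) (x : N) (v w : TangentSpace 𝓘(ℝ, E) x) :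
    mvfderiv 𝓘(ℝ, E) (fun y ↦ σ y (extend E w y)) x v
      = fderiv ℝ (coordForm σ x ∘ (extChartAt 𝓘(ℝ, E) x).symm) (extChartAt 𝓘(ℝ, E) x x)
        (v : E) (w : E) := by
  have h := ((hσ.contMDiffAt_coordForm x).contDiffAt_comp_extChartAt_symm le_rfl).differentiableAt
    (by simp)
  refine Eq.trans ?_ (mvfderiv_clm_comp_extChartAt h v w)
  refine Filter.EventuallyEq.mvfderiv_apply_eq ?_ v
  filter_upwards [chart_source_mem_nhds E x] with y hy
  rw [Function.comp_apply, (extChartAt 𝓘(ℝ, E) x).left_inv (by simpa using hy)]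
  exact (coordForm_apply hy w).symm

end ChartForm

section Slices

variable {E E' F : Type*} [NormedAddCommGroup E] [NormedSpace ℝ E]
  [NormedAddCommGroup E'] [NormedSpace ℝ E'] [NormedAddCommGroup F] [NormedSpace ℝ F]

theorem fderiv_slice_left {f : E × E' → F} {x : E × E'} (hf : DifferentiableAt ℝ f x) (w : E) :
    fderiv ℝ f x (w, 0) = fderiv ℝ (fun p ↦ f (p, x.2)) x.1 w := by
  have h := HasFDerivAt.comp x.1 (g := f) (f := fun p ↦ (p, x.2)) hf.hasFDerivAt
    (hasFDerivAt_prodMk_left x.1 x.2)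
  exact (congrArg (fun L : E →L[ℝ] F ↦ L w) h.fderiv).symm

theorem fderiv_slice_right {f : E × E' → F} {x : E × E'} (hf : DifferentiableAt ℝ f x) (w : E') :
    fderiv ℝ f x (0, w) = fderiv ℝ (fun p ↦ f (x.1, p)) x.2 w := by
  have h := HasFDerivAt.comp x.2 (g := f) (f := fun p ↦ (x.1, p)) hf.hasFDerivAt
    (hasFDerivAt_prodMk_right x.1 x.2)
  exact (congrArg (fun L : E' →L[ℝ] F ↦ L w) h.fderiv).symm

end Slices

/-! ### Vertical vectors and the solder form -/

section Vertical

variable {EG EP EM : Type*}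
  [NormedAddCommGroup EG] [NormedSpace ℝ EG]
  [NormedAddCommGroup EP] [NormedSpace ℝ EP]
  [NormedAddCommGroup EM] [NormedSpace ℝ EM]
  {G P M : Type*}
  [TopologicalSpace G] [ChartedSpace EG G] [Group G] [LieGroup 𝓘(ℝ, EG) ∞ G]
  [TopologicalSpace P] [ChartedSpace EP P] [IsManifold 𝓘(ℝ, EP) ∞ P]
  [TopologicalSpace M] [ChartedSpace EM M] [IsManifold 𝓘(ℝ, EM) ∞ M]

namespace SmoothPrincipalBundle

variable (Q : SmoothPrincipalBundle EG EP EM G P M)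

theorem contMDiff_act_left (z : P) : ContMDiff 𝓘(ℝ, EG) 𝓘(ℝ, EP) ∞ (fun g ↦ Q.act z g) :=
  Q.smooth_act.comp (contMDiff_const.prodMk contMDiff_id)

theorem contMDiff_act_right (g : G) : ContMDiff 𝓘(ℝ, EP) 𝓘(ℝ, EP) ∞ (fun z ↦ Q.act z g) :=
  Q.smooth_act.comp (contMDiff_id.prodMk contMDiff_const)

/-- A tangent vector which projects to zero is a value of a fundamental vector field. -/
theorem exists_fundamentalVector_eq (z : P) (V : TangentSpace 𝓘(ℝ, EP) z)
    (hV : mfderiv 𝓘(ℝ, EP) 𝓘(ℝ, EM) Q.proj z V = 0) :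
    ∃ h : TangentSpace 𝓘(ℝ, EG) (1 : G), (Q.fundamentalVector z h : EP) = (V : EP) := by
  obtain ⟨U, hU, hzU, s, t, hs, ht, h1, h2⟩ := Q.locally_trivial (Q.proj z)
  have hUz : Q.proj ⁻¹' U ∈ 𝓝 z :=
    (hU.preimage Q.smooth_proj.continuous).mem_nhds hzU
  have hsd : MDifferentiableAt 𝓘(ℝ, EM) 𝓘(ℝ, EP) s (Q.proj z) :=
    (hs.contMDiffAt (hU.mem_nhds hzU)).mdifferentiableAt (by simp)
  have htd : MDifferentiableAt 𝓘(ℝ, EP) 𝓘(ℝ, EG) t z :=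
    (ht.contMDiffAt hUz).mdifferentiableAt (by simp)
  have hpd : MDifferentiableAt 𝓘(ℝ, EP) 𝓘(ℝ, EM) Q.proj z :=
    Q.smooth_proj.mdifferentiable (by simp) z
  have hspd := hsd.comp z hpd
  let τ : TangentSpace 𝓘(ℝ, EG) (t z) := mfderiv 𝓘(ℝ, EP) 𝓘(ℝ, EG) t z V
  let m : P := s (Q.proj z)
  have hact := Q.smooth_act.mdifferentiable (by simp) (m, t z)
  have e1 : mfderiv 𝓘(ℝ, EP) 𝓘(ℝ, EP) (s ∘ Q.proj) z V = 0 := by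
    rw [mfderiv_comp_apply z hsd hpd, hV, map_zero]
  -- Differentiating `y = s(π y) · t(y)` along `V`: the contribution of `s ∘ π` vanishes since `V`
  -- is vertical, so `V` is tangent to the orbit of `m`.
  have e2 : (mfderiv 𝓘(ℝ, EG) 𝓘(ℝ, EP) (fun g ↦ Q.act m g) (t z) τ : EP) = (V : EP) := by
    have hid : (fun y ↦ Q.act (s (Q.proj y)) (t y)) =ᶠ[𝓝 z] id := by
      filter_upwards [hUz] with y hy using h2 y hy
    have a1 := mfderiv_comp_apply (I' := 𝓘(ℝ, EP).prod 𝓘(ℝ, EG)) (I'' := 𝓘(ℝ, EP)) z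
      (g := fun z : P × G ↦ Q.act z.1 z.2) (f := fun y ↦ ((s ∘ Q.proj) y, t y)) hact
      (hspd.prodMk htd) V
    have a2 := mfderiv_comp_apply (I' := 𝓘(ℝ, EP).prod 𝓘(ℝ, EG)) (I'' := 𝓘(ℝ, EP)) (t z)
      (g := fun z : P × G ↦ Q.act z.1 z.2) (f := fun g ↦ (m, g)) hact
      ((mdifferentiableAt_const (c := m)).prodMk mdifferentiableAt_id) τ
    rw [mfderiv_prodMk hspd htd] at a1
    have a4 := mfderiv_prodMk (I := 𝓘(ℝ, EG)) (I' := 𝓘(ℝ, EP)) (I'' := 𝓘(ℝ, EG)) (x := t z)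
      (mdifferentiableAt_const (c := m)) mdifferentiableAt_id
    rw [mfderiv_const, mfderiv_id] at a4
    replace a2 := a2.trans (congrArg (fun L : EG →L[ℝ] EP × EG ↦ mfderiv
      (𝓘(ℝ, EP).prod 𝓘(ℝ, EG)) 𝓘(ℝ, EP) (fun z : P × G ↦ Q.act z.1 z.2) (m, t z) (L τ)) a4)
    have a3 : (mfderiv 𝓘(ℝ, EP) 𝓘(ℝ, EP) (fun y ↦ Q.act (s (Q.proj y)) (t y)) z V : EP) = V := by
      have := hid.mfderiv_eq (I := 𝓘(ℝ, EP)) (I' := 𝓘(ℝ, EP))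
      refine (congrArg (fun L : EP →L[ℝ] EP ↦ L V) this).trans ?_
      rw [mfderiv_id]
      rfl
    refine Eq.trans ?_ a3
    refine a2.trans (Eq.trans ?_ a1.symm)
    refine congrArg (mfderiv (𝓘(ℝ, EP).prod 𝓘(ℝ, EG)) 𝓘(ℝ, EP)
      (fun z : P × G ↦ Q.act z.1 z.2) (m, t z)) ?_
    exact Prod.ext e1.symm rfl
  have hmul : MDifferentiableAt 𝓘(ℝ, EG) 𝓘(ℝ, EG) (fun g ↦ (t z)⁻¹ * g) (t z) :=
    (contMDiff_mul_left (I := 𝓘(ℝ, EG)) (n := ∞)).mdifferentiable (by simp) _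
  refine ⟨(mfderiv 𝓘(ℝ, EG) 𝓘(ℝ, EG) (fun g ↦ (t z)⁻¹ * g) (t z) τ : EG), ?_⟩
  rw [← e2]
  -- Left translation by `(t z)⁻¹` moves the base point of the orbit map from `m` to `z = m · t z`,
  -- and its argument from `t z` to `1`.
  have hfun : (fun g ↦ Q.act m g) = (fun g ↦ Q.act z g) ∘ (fun g ↦ (t z)⁻¹ * g) := by
    ext g
    have hz : Q.act m (t z) = z := h2 z hzU
    calc Q.act m g = Q.act m (t z * ((t z)⁻¹ * g)) := by rw [mul_inv_cancel_left]
      _ = Q.act z ((t z)⁻¹ * g) := by rw [Q.act_mul, hz]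
  rw [hfun]
  exact (mfderiv_comp_apply_of_eq (t z)
    ((Q.contMDiff_act_left z).mdifferentiable (by simp) 1) hmul (by simp) τ).symm

end SmoothPrincipalBundle

namespace OrthonormalFrameBundle

variable {p q : ℕ} (Q : OrthonormalFrameBundle EG EP EM G P M p q)

theorem solder_fundamentalVector (z : P) (h : TangentSpace 𝓘(ℝ, EG) (1 : G)) :
    Q.solder (Q.act z 1) (Q.fundamentalVector z h) = 0 := by
  rw [Q.solder_eq_zero_iff]
  have hc := mfderiv_comp_apply (1 : G) (Q.smooth_proj.mdifferentiable (by simp) (Q.act z 1))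
    ((Q.contMDiff_act_left z).mdifferentiable (by simp) 1) h
  have hconst : Q.proj ∘ (fun g ↦ Q.act z g) = fun _ ↦ Q.proj z := funext fun g ↦ Q.proj_act z g
  rw [SmoothPrincipalBundle.fundamentalVector, ← hc, hconst, mfderiv_const]
  rfl

theorem rep_solder_act (z : P) (g : G) (v : TangentSpace 𝓘(ℝ, EP) z) :
    Q.rep g (Q.solder (Q.act z g) (mfderiv 𝓘(ℝ, EP) 𝓘(ℝ, EP) (fun y ↦ Q.act y g) z v))
      = Q.solder z v := by
  rw [Q.solder_equivariant, ← mul_apply_eq_comp, ← map_mul, mul_inv_cancel, map_one,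
    one_apply_eq_self]

/-- The action of the structure group, read in the charts at `z` and at `1`. -/
def chartAct (z : P) (x : EP × EG) : EP :=
  extChartAt 𝓘(ℝ, EP) z
    (Q.act ((extChartAt 𝓘(ℝ, EP) z).symm x.1) ((extChartAt 𝓘(ℝ, EG) (1 : G)).symm x.2))

theorem contDiffAt_chartAct (z : P) : ContDiffAt ℝ 2 (Q.chartAct z)
    (extChartAt 𝓘(ℝ, EP) z z, extChartAt 𝓘(ℝ, EG) (1 : G) 1) := by
  rw [← contMDiffAt_iff_contDiffAt]
  have h1 : ContMDiffAt 𝓘(ℝ, EP × EG) 𝓘(ℝ, EP) ∞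
      (fun x : EP × EG ↦ (extChartAt 𝓘(ℝ, EP) z).symm x.1)
      (extChartAt 𝓘(ℝ, EP) z z, extChartAt 𝓘(ℝ, EG) (1 : G) 1) :=
    ((contMDiffOn_extChartAt_symm z).contMDiffAt (extChartAt_target_mem_nhds z)).comp
      (extChartAt 𝓘(ℝ, EP) z z, extChartAt 𝓘(ℝ, EG) (1 : G) 1) contDiffAt_fst.contMDiffAt
  have h2 : ContMDiffAt 𝓘(ℝ, EP × EG) 𝓘(ℝ, EG) ∞
      (fun x : EP × EG ↦ (extChartAt 𝓘(ℝ, EG) (1 : G)).symm x.2)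
      (extChartAt 𝓘(ℝ, EP) z z, extChartAt 𝓘(ℝ, EG) (1 : G) 1) :=
    ((contMDiffOn_extChartAt_symm (1 : G)).contMDiffAt (extChartAt_target_mem_nhds 1)).comp
      (extChartAt 𝓘(ℝ, EP) z z, extChartAt 𝓘(ℝ, EG) (1 : G) 1) contDiffAt_snd.contMDiffAt
  refine ContMDiffAt.of_le ?_ two_le_infty
  refine ContMDiffAt.comp (I' := 𝓘(ℝ, EP)) (n := ∞) _ ?_
    ((Q.smooth_act _).comp _ (h1.prodMk h2))
  refine contMDiffAt_extChartAt' ?_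
  simp only [extChartAt_to_inv, Q.act_one]
  exact mem_chart_source EP z

/-- Cartan's formula in charts: `α` vanishes on fundamental fields, so contracting `dα` with one
gives the Lie derivative of `α`, which equivariance determines. Taking `H` in the model space keeps
the base point `z · 1` out of its type. -/
theorem fderiv_coordForm_solder (z : P) (w : EP) (h : EG) (H : EP)
    (hH : H = (mfderiv 𝓘(ℝ, EG) 𝓘(ℝ, EP) (fun g ↦ Q.act z g) 1 (asTangent (1 : G) h) : EP)) :
    fderiv ℝ (coordForm Q.solder z ∘ (extChartAt 𝓘(ℝ, EP) z).symm) (extChartAt 𝓘(ℝ, EP) z z) H w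
      - fderiv ℝ (coordForm Q.solder z ∘ (extChartAt 𝓘(ℝ, EP) z).symm) (extChartAt 𝓘(ℝ, EP) z z)
        w H = - mvfderiv 𝓘(ℝ, EG) Q.rep 1 (asTangent (1 : G) h) (Q.solder z (asTangent z w)) := by
  have hF := Q.contDiffAt_chartAct z
  have hFd : ∀ᶠ x in 𝓝 (extChartAt 𝓘(ℝ, EP) z z, extChartAt 𝓘(ℝ, EG) (1 : G) 1),
      DifferentiableAt ℝ (Q.chartAct z) x :=
    (hF.eventually (by simp)).mono fun x hx ↦ hx.differentiableAt (by simp)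
  have hz : (extChartAt 𝓘(ℝ, EP) z).symm (extChartAt 𝓘(ℝ, EP) z z) = z := extChartAt_to_inv z
  have h1 : (extChartAt 𝓘(ℝ, EG) (1 : G)).symm (extChartAt 𝓘(ℝ, EG) (1 : G) 1) = 1 :=
    extChartAt_to_inv (1 : G)
  have hFz : ∀ᶠ p in 𝓝 (extChartAt 𝓘(ℝ, EP) z z),
      Q.chartAct z (p, extChartAt 𝓘(ℝ, EG) (1 : G) 1) = p := by
    filter_upwards [extChartAt_target_mem_nhds (I := 𝓘(ℝ, EP)) z] with p hp
    simp only [chartAct, h1, Q.act_one]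
    exact (extChartAt 𝓘(ℝ, EP) z).right_inv hp
  have hr := mvfderiv_eq_fderiv (x := (1 : G)) (Q.smooth_rep.mdifferentiable (by simp) 1)
    (asTangent (1 : G) h)
  have hrd : DifferentiableAt ℝ (Q.rep ∘ (extChartAt 𝓘(ℝ, EG) (1 : G)).symm)
      (extChartAt 𝓘(ℝ, EG) (1 : G) 1) :=
    ((Q.smooth_rep.contMDiffAt (x := 1)).contDiffAt_comp_extChartAt_symm le_rfl).differentiableAt
      (by simp)
  have had : DifferentiableAt ℝ (coordForm Q.solder z ∘ (extChartAt 𝓘(ℝ, EP) z).symm)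
      (extChartAt 𝓘(ℝ, EP) z z) :=
    ((Q.smooth_solder.contMDiffAt_coordForm z).contDiffAt_comp_extChartAt_symm
      le_rfl).differentiableAt (by simp)
  have hright (y : P) (hy : y ∈ (chartAt EP z).source) (g : G)
      (hg : Q.act y g ∈ (chartAt EP z).source) (u : TangentSpace 𝓘(ℝ, EP) z) :=
    coordForm_fderiv (σ := Q.solder) (f := fun y ↦ Q.act y g) hy hg
      ((Q.contMDiff_act_right g).mdifferentiable (by simp) y) u
  have hleft (y : P) (hy : Q.act y 1 ∈ (chartAt EP z).source) :=
    coordForm_fderiv (σ := Q.solder) (f := fun g ↦ Q.act y g) (mem_chart_source EG (1 : G)) hy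
      ((Q.contMDiff_act_left y).mdifferentiable (by simp) 1) (asTangent (1 : G) h)
  have hDH : fderiv ℝ (Q.chartAct z) (extChartAt 𝓘(ℝ, EP) z z, extChartAt 𝓘(ℝ, EG) (1 : G) 1) (0, h)
      = H := by
    rw [fderiv_slice_right hFd.self_of_nhds, hH]
    simp only [chartAct, hz]
    have d1 : MDifferentiableAt 𝓘(ℝ, EP) 𝓘(ℝ, EP) (extChartAt 𝓘(ℝ, EP) z) z :=
      mdifferentiableAt_extChartAt (mem_chart_source EP z)
    have d2 := (Q.contMDiff_act_left z).mdifferentiable (by simp) 1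
    have a1 := mvfderiv_eq_fderiv (x := (1 : G)) (MDifferentiableAt.comp_of_eq _ d1 d2 (Q.act_one z))
      (asTangent (1 : G) h)
    have a2 := mfderiv_comp_apply_of_eq (1 : G) d1 d2 (Q.act_one z) (asTangent (1 : G) h)
    refine a1.symm.trans (a2.trans ?_)
    rw [mfderiv_extChartAt_self]
    rfl
  have hDw (w : EP) : fderiv ℝ (Q.chartAct z)
      (extChartAt 𝓘(ℝ, EP) z z, extChartAt 𝓘(ℝ, EG) (1 : G) 1) (w, 0) = w := by
    rw [fderiv_slice_left hFd.self_of_nhds, Filter.EventuallyEq.fderiv_eq (f := id) hFz, fderiv_id]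
    rfl
  have key := fderiv_sub_fderiv_of_equivariant hF hFz.self_of_nhds hDw had hrd
    (by rw [Function.comp_apply, h1, map_one]; rfl) w h ?_ ?_
  · rw [hDH, Function.comp_apply, hz] at key
    rw [hr]
    exact key.trans (congrArg (fun u ↦ - fderiv ℝ (Q.rep ∘ (extChartAt 𝓘(ℝ, EG) (1 : G)).symm)
      (extChartAt 𝓘(ℝ, EG) (1 : G) 1) h u) (coordForm_self z (asTangent z w)))
  -- Equivariance at `z`: `rep g` undoes the effect of the right translation by `g` on `α`.
  · have hc : ∀ᶠ e in 𝓝 (extChartAt 𝓘(ℝ, EG) (1 : G) 1),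
        Q.act z ((extChartAt 𝓘(ℝ, EG) (1 : G)).symm e) ∈ (chartAt EP z).source := by
      have : ContinuousAt (fun e ↦ Q.act z ((extChartAt 𝓘(ℝ, EG) (1 : G)).symm e))
          (extChartAt 𝓘(ℝ, EG) (1 : G) 1) :=
        (Q.contMDiff_act_left z).continuous.continuousAt.comp (continuousAt_extChartAt_symm (1 : G))
      refine this.eventually_mem ?_
      rw [h1, Q.act_one]
      exact chart_source_mem_nhds EP z
    filter_upwards [(Continuous.prodMk_right _).continuousAt.eventually hFd, hc] with e he hce
    rw [fderiv_slice_left he]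
    have := hright z (mem_chart_source EP z) _ hce (asTangent z w)
    rw [extend_apply_self] at this
    have e1 : (coordForm Q.solder z ∘ (extChartAt 𝓘(ℝ, EP) z).symm)
        (Q.chartAct z (extChartAt 𝓘(ℝ, EP) z z, e))
        = coordForm Q.solder z (Q.act z ((extChartAt 𝓘(ℝ, EG) (1 : G)).symm e)) := by
      simp only [chartAct, Function.comp_apply, hz]
      rw [(extChartAt 𝓘(ℝ, EP) z).left_inv (by simpa using hce)]
    rw [e1, Function.comp_apply, Function.comp_apply, hz]
    refine Eq.trans ?_ (coordForm_self z (asTangent z w)).symm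
    exact (congrArg _ this).trans (Q.rep_solder_act z _ (asTangent z w))
  -- Vanishing of `α` on the fundamental field at every point near `z`.
  · have hc : ∀ᶠ p in 𝓝 (extChartAt 𝓘(ℝ, EP) z z),
        (extChartAt 𝓘(ℝ, EP) z).symm p ∈ (chartAt EP z).source := by
      filter_upwards [extChartAt_target_mem_nhds (I := 𝓘(ℝ, EP)) z] with p hp
      simpa using (extChartAt 𝓘(ℝ, EP) z).map_target hp
    filter_upwards [(Continuous.prodMk_left _).continuousAt.eventually hFd, hc] with p hp hcp
    have := hleft ((extChartAt 𝓘(ℝ, EP) z).symm p) (by rwa [Q.act_one])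
    rw [extend_apply_self] at this
    rw [fderiv_slice_right hp]
    have e1 : (coordForm Q.solder z ∘ (extChartAt 𝓘(ℝ, EP) z).symm)
        (Q.chartAct z (p, extChartAt 𝓘(ℝ, EG) (1 : G) 1))
        = coordForm Q.solder z (Q.act ((extChartAt 𝓘(ℝ, EP) z).symm p) 1) := by
      simp only [chartAct, Function.comp_apply, h1]
      rw [(extChartAt 𝓘(ℝ, EP) z).left_inv (by simpa [Q.act_one] using hcp)]
    rw [e1]
    exact this.trans (Q.solder_fundamentalVector _ (asTangent (1 : G) h))

theorem extDerivOneForm_solder_fundamentalVector [CompleteSpace EP] (z : P)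
    (h : TangentSpace 𝓘(ℝ, EG) (1 : G)) (w : TangentSpace 𝓘(ℝ, EP) (Q.act z 1)) :
    extDerivOneForm (fun y v ↦ Q.solder y v) (Q.act z 1) (Q.fundamentalVector z h) w
      = - mvfderiv 𝓘(ℝ, EG) Q.rep 1 h (Q.solder (Q.act z 1) w) := by
  refine (extDerivOneForm_eq_sub (fun y v ↦ Q.solder y v) (Q.act z 1) (map_zero _) _ w).trans ?_
  rw [mvfderiv_apply_extend Q.smooth_solder, mvfderiv_apply_extend Q.smooth_solder]
  have e : (fun g ↦ Q.act z g) = fun g ↦ Q.act (Q.act z 1) g := by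
    simp only [Q.act_one]
  refine Q.fderiv_coordForm_solder (Q.act z 1) w h _ ?_
  exact congrArg (fun f : G → P ↦ (mfderiv 𝓘(ℝ, EG) 𝓘(ℝ, EP) f 1 h : EP)) e

end OrthonormalFrameBundle

end Vertical

/-! ### Bilinearity of `d`, and smoothness detected by an injective form -/

section ExtDeriv

variable {E : Type*} [NormedAddCommGroup E] [NormedSpace ℝ E] [CompleteSpace E]
  {N : Type*} [TopologicalSpace N] [ChartedSpace E N] [IsManifold 𝓘(ℝ, E) ∞ N]
  {W : Type*} [NormedAddCommGroup W] [NormedSpace ℝ W]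
  {σ : Π x : N, TangentSpace 𝓘(ℝ, E) x →L[ℝ] W}

theorem extDerivOneForm_swap (x : N)
    (v w : TangentSpace 𝓘(ℝ, E) x) :
    extDerivOneForm (fun y v ↦ σ y v) x v w = - extDerivOneForm (fun y v ↦ σ y v) x w v := by
  have h (v w : TangentSpace 𝓘(ℝ, E) x) :=
    extDerivOneForm_eq_sub (fun y v ↦ σ y v) x (map_zero _) v w
  rw [h, h, neg_sub]

theorem IsSmoothOneForm.extDerivOneForm_add (hσ : IsSmoothOneForm σ) (x : N)
    (v w w' : TangentSpace 𝓘(ℝ, E) x) :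
    extDerivOneForm (fun y v ↦ σ y v) x v (w + w') = extDerivOneForm (fun y v ↦ σ y v) x v w
      + extDerivOneForm (fun y v ↦ σ y v) x v w' := by
  have h (v w : TangentSpace 𝓘(ℝ, E) x) :=
    extDerivOneForm_eq_sub (fun y v ↦ σ y v) x (map_zero _) v w
  simp only [h, mvfderiv_apply_extend hσ]
  have e1 := map_add (fderiv ℝ (coordForm σ x ∘ (extChartAt 𝓘(ℝ, E) x).symm)
    (extChartAt 𝓘(ℝ, E) x x) v) w w'
  have e2 := (fderiv ℝ (coordForm σ x ∘ (extChartAt 𝓘(ℝ, E) x).symm)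
    (extChartAt 𝓘(ℝ, E) x x)).map_add₂ w w' v
  exact (congrArg₂ _ e1 e2).trans (add_sub_add_comm _ _ _ _)

theorem IsSmoothOneForm.extDerivOneForm_smul (hσ : IsSmoothOneForm σ) (x : N) (c : ℝ)
    (v w : TangentSpace 𝓘(ℝ, E) x) :
    extDerivOneForm (fun y v ↦ σ y v) x v (c • w)
      = c • extDerivOneForm (fun y v ↦ σ y v) x v w := by
  have h (v w : TangentSpace 𝓘(ℝ, E) x) :=
    extDerivOneForm_eq_sub (fun y v ↦ σ y v) x (map_zero _) v w
  simp only [h, mvfderiv_apply_extend hσ]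
  have e1 := map_smul (fderiv ℝ (coordForm σ x ∘ (extChartAt 𝓘(ℝ, E) x).symm)
    (extChartAt 𝓘(ℝ, E) x x) v) c w
  have e2 := (fderiv ℝ (coordForm σ x ∘ (extChartAt 𝓘(ℝ, E) x).symm)
    (extChartAt 𝓘(ℝ, E) x x)).map_smul₂ c w v
  exact (congrArg₂ _ e1 e2).trans (smul_sub _ _ _).symm

theorem contMDiffAt_coordForm_prod {W' : Type*} [NormedAddCommGroup W'] [NormedSpace ℝ W']
    {σ' : Π x : N, TangentSpace 𝓘(ℝ, E) x →L[ℝ] W'} {x : N}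
    (h : ContMDiffAt 𝓘(ℝ, E) 𝓘(ℝ, E →L[ℝ] W) ∞ (coordForm σ x) x)
    (h' : ContMDiffAt 𝓘(ℝ, E) 𝓘(ℝ, E →L[ℝ] W') ∞ (coordForm σ' x) x) :
    ContMDiffAt 𝓘(ℝ, E) 𝓘(ℝ, E →L[ℝ] W × W') ∞ (coordForm (fun y ↦ (σ y).prod (σ' y)) x) x := by
  let L : (E →L[ℝ] W) × (E →L[ℝ] W') →L[ℝ] E →L[ℝ] W × W' :=
    (ContinuousLinearMap.prodL ℝ : _ ≃L[ℝ] _).toContinuousLinearMap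
  exact ContMDiffAt.comp x L.contMDiff.contMDiffAt (h.prodMk_space h')

/-- If a one-form is injective at `x`, then a vector field on which it is smooth at `x` is smooth
at `x`. -/
theorem contMDiffAt_of_injective [FiniteDimensional ℝ E] [FiniteDimensional ℝ W]
    {x : N} (hσ : ContMDiffAt 𝓘(ℝ, E) 𝓘(ℝ, E →L[ℝ] W) ∞ (coordForm σ x) x) (hinj : ∀ v, σ x v = 0 → v = 0)
    {X : Π x : N, TangentSpace 𝓘(ℝ, E) x}
    (hX : ContMDiffAt 𝓘(ℝ, E) 𝓘(ℝ, W) ∞ (fun y ↦ σ y (X y)) x) :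
    ContMDiffAt 𝓘(ℝ, E) 𝓘(ℝ, E).tangent ∞ (T% X) x := by
  -- Near `x` the map `Λ ∘ σ_y` is a perturbation of the identity, hence invertible with smooth
  -- inverse; this solves for the coordinates of `X y` in terms of `σ y (X y)`.
  obtain ⟨Λ, hΛ⟩ := LinearMap.exists_leftInverse_of_injective
    (coordForm σ x x).toLinearMap (LinearMap.ker_eq_bot'.2 fun v hv ↦
      hinj (asTangent x v) ((coordForm_self x (asTangent x v)).symm.trans hv))
  let Λ' : W →L[ℝ] E := LinearMap.toContinuousLinearMap Λ
  let C : N → E →L[ℝ] E := fun y ↦ Λ' ∘L coordForm σ x y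
  have hC : ContMDiffAt 𝓘(ℝ, E) 𝓘(ℝ, E →L[ℝ] E) ∞ C x :=
    contMDiffAt_const.clm_comp hσ
  have hCx : C x = ContinuousLinearEquiv.refl ℝ E := by
    ext v
    exact congrArg (fun L : E →ₗ[ℝ] E ↦ L v) hΛ
  have hinv : ContMDiffAt 𝓘(ℝ, E) 𝓘(ℝ, E →L[ℝ] E) ∞ (fun y ↦ (C y).inverse) x := by
    have h := contDiffAt_map_inverse (n := ∞) (ContinuousLinearEquiv.refl ℝ E)
    rw [← hCx] at h
    exact h.contMDiffAt.comp x hC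
  have hunit : ∀ᶠ y in 𝓝 x, ∃ e : E ≃L[ℝ] E, (e : E →L[ℝ] E) = C y := by
    refine hC.continuousAt.eventually_mem (s := Set.range ((↑) : (E ≃L[ℝ] E) → E →L[ℝ] E)) ?_
    rw [hCx]
    exact (ContinuousLinearEquiv.refl ℝ E).nhds
  have hres : ContMDiffAt 𝓘(ℝ, E) 𝓘(ℝ, E) ∞ (fun y ↦ (C y).inverse (Λ' (σ y (X y)))) x :=
    hinv.clm_apply (contMDiffAt_const.clm_apply hX)
  rw [contMDiffAt_section]
  refine hres.congr_of_eventuallyEq ?_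
  filter_upwards [hunit, chart_source_mem_nhds E x] with y ⟨e, he⟩ hy
  have h1 : coordAt x y (X y) = ((trivializationAt E (TangentSpace 𝓘(ℝ, E)) x) ⟨y, X y⟩).2 :=
    Trivialization.continuousLinearMapAt_apply_of_mem ℝ _ hy _
  refine h1.symm.trans ?_
  have h2 : extend E (asTangent x (coordAt x y (X y))) y = X y := by
    rw [extend_eq_symmL hy]
    exact Trivialization.symmL_continuousLinearMapAt _ hy _
  have h3 : C y (coordAt x y (X y)) = Λ' (σ y (X y)) := by
    refine congrArg Λ' ((coordForm_apply hy (asTangent x (coordAt x y (X y)))).trans ?_)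
    rw [h2]
  rw [← h3, ← he, ContinuousLinearMap.inverse_equiv]
  exact (e.symm_apply_apply _).symm

end ExtDeriv

/-! ### Horizontal fields and horizontality of the torsion form -/

section Horizontal

variable {EG EP EM : Type*}
  [NormedAddCommGroup EG] [NormedSpace ℝ EG]
  [NormedAddCommGroup EP] [NormedSpace ℝ EP] [FiniteDimensional ℝ EP]
  [NormedAddCommGroup EM] [NormedSpace ℝ EM]
  {G P M : Type*}
  [TopologicalSpace G] [ChartedSpace EG G] [Group G] [LieGroup 𝓘(ℝ, EG) ∞ G]
  [TopologicalSpace P] [ChartedSpace EP P] [IsManifold 𝓘(ℝ, EP) ∞ P]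
  [TopologicalSpace M] [ChartedSpace EM M] [IsManifold 𝓘(ℝ, EM) ∞ M]
  {p q : ℕ} {Q : OrthonormalFrameBundle EG EP EM G P M p q} (conn : ConnectionForm Q)

/-- The basis is orthogonal for `η` with nonzero squares, so skewness forces the diagonal entries to
vanish. -/
theorem IsSkewEta.apply_stdVec {A : Rpq p q →L[ℝ] Rpq p q} (hA : IsSkewEta A)
    (c : Fin p ⊕ Fin q) : A (stdVec p q c) c = 0 := by
  have h := hA (stdVec p q c) (stdVec p q c)
  rcases c with i | j
  · simp [etaForm, stdVec, Pi.single_apply] at h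
    simpa [stdVec] using h
  · simp [etaForm, stdVec, Pi.single_apply] at h
    have : A (stdVec p q (Sum.inr j)) (Sum.inr j) = 0 := by
      simp only [stdVec]
      linarith
    exact this

namespace ConnectionForm

theorem form_hor (a : Rpq p q) (z : P) : conn.form z (conn.hor a z) = 0 :=
  (conn.exists_horizontal z a).choose_spec.1

theorem solder_hor (a : Rpq p q) (z : P) : Q.solder z (conn.hor a z) = a :=
  (conn.exists_horizontal z a).choose_spec.2

/-- A vector killed by `α` is vertical, hence fundamental for some `h`; then `ω` returns the
differential of `rep` at `h`, which is injective. -/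
theorem eq_zero_of_form_solder {z : P} {v : TangentSpace 𝓘(ℝ, EP) z}
    (h₁ : conn.form z v = 0) (h₂ : Q.solder z v = 0) : v = 0 := by
  obtain ⟨h, hh⟩ := Q.exists_fundamentalVector_eq z v ((Q.solder_eq_zero_iff z v).1 h₂)
  -- Fundamental vectors live over `z · 1`, equal to `z` only propositionally; `key` transports
  -- along this equality.
  have key (z' : P) (hz : z' = z) (V : TangentSpace 𝓘(ℝ, EP) z') (hV : (V : EP) = (v : EP)) :
      conn.form z' V = conn.form z v := by
    subst hz
    exact congrArg (conn.form z') hV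
  have h3 := (conn.normalized z h).symm.trans ((key _ (Q.act_one z) _ hh).trans h₁)
  have h4 : h = 0 := Q.rep_lie.injOn (Set.mem_univ _) (Set.mem_univ _) (h3.trans (map_zero _).symm)
  rw [h4] at hh
  exact hh.symm.trans (map_zero _)

theorem eq_of_form_solder {z : P} {v w : TangentSpace 𝓘(ℝ, EP) z}
    (h₁ : conn.form z v = conn.form z w) (h₂ : Q.solder z v = Q.solder z w) : v = w := by
  rw [← sub_eq_zero]
  refine conn.eq_zero_of_form_solder ?_ ?_
  · rw [map_sub, h₁, sub_self]
  · rw [map_sub, h₂, sub_self]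

theorem hor_add (a b : Rpq p q) (z : P) :
    conn.hor (a + b) z = conn.hor a z + conn.hor b z := by
  refine conn.eq_of_form_solder ?_ ?_
  · rw [map_add, form_hor, form_hor, form_hor, add_zero]
  · rw [map_add, solder_hor, solder_hor, solder_hor]

theorem hor_smul (c : ℝ) (a : Rpq p q) (z : P) : conn.hor (c • a) z = c • conn.hor a z := by
  refine conn.eq_of_form_solder ?_ ?_
  · rw [map_smul, form_hor, form_hor, smul_zero]
  · rw [map_smul, solder_hor, solder_hor]

/-- `u_a` is chosen point by point, but the injective smooth form `(ω, α)` takes the constant value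
`(0, a)` on it. -/
theorem contMDiff_hor (a : Rpq p q) (z : P) :
    ContMDiffAt 𝓘(ℝ, EP) 𝓘(ℝ, EP).tangent ∞ (T% (conn.hor a)) z := by
  have : CompleteSpace EP := FiniteDimensional.complete ℝ EP
  let σ : Π y : P, TangentSpace 𝓘(ℝ, EP) y →L[ℝ] (Rpq p q →L[ℝ] Rpq p q) × Rpq p q :=
    fun y ↦ (conn.form y).prod (Q.solder y)
  have hσ : ContMDiffAt 𝓘(ℝ, EP) 𝓘(ℝ, EP →L[ℝ] (Rpq p q →L[ℝ] Rpq p q) × Rpq p q) ∞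
      (coordForm σ z) z :=
    contMDiffAt_coordForm_prod (conn.smooth.contMDiffAt_coordForm z)
      (Q.smooth_solder.contMDiffAt_coordForm z)
  refine contMDiffAt_of_injective hσ (fun v hv ↦ ?_) ?_
  · exact conn.eq_zero_of_form_solder (congrArg Prod.fst hv) (congrArg Prod.snd hv)
  · have e : (fun y ↦ σ y (conn.hor a y)) = fun _ ↦ (0, a) :=
      funext fun y ↦ Prod.ext (conn.form_hor a y) (conn.solder_hor a y)
    rw [e]
    exact contMDiffAt_const

theorem mdifferentiableAt_hor (a : Rpq p q) (z : P) : MDiffAt (T% (conn.hor a)) z :=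
  (conn.contMDiff_hor a z).mdifferentiableAt (by simp)

theorem torsionForm_swap (z : P) (v w : TangentSpace 𝓘(ℝ, EP) z) :
    conn.torsionForm z v w = - conn.torsionForm z w v := by
  have : CompleteSpace EP := FiniteDimensional.complete ℝ EP
  rw [torsionForm, torsionForm, extDerivOneForm_swap (σ := Q.solder)]
  abel

theorem torsionForm_add (z : P) (v w w' : TangentSpace 𝓘(ℝ, EP) z) :
    conn.torsionForm z v (w + w') = conn.torsionForm z v w + conn.torsionForm z v w' := by
  have : CompleteSpace EP := FiniteDimensional.complete ℝ EP
  simp only [torsionForm]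
  rw [Q.smooth_solder.extDerivOneForm_add, map_add, map_add, map_add, add_apply]
  abel

theorem torsionForm_smul (z : P) (c : ℝ) (v w : TangentSpace 𝓘(ℝ, EP) z) :
    conn.torsionForm z v (c • w) = c • conn.torsionForm z v w := by
  have : CompleteSpace EP := FiniteDimensional.complete ℝ EP
  simp only [torsionForm]
  rw [Q.smooth_solder.extDerivOneForm_smul, map_smul, map_smul, map_smul, smul_apply]
  module

/-- The torsion form is horizontal. -/
theorem torsionForm_eq_zero (z : P) {v : TangentSpace 𝓘(ℝ, EP) z} (hv : Q.solder z v = 0)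
    (w : TangentSpace 𝓘(ℝ, EP) z) : conn.torsionForm z v w = 0 := by
  have : CompleteSpace EP := FiniteDimensional.complete ℝ EP
  obtain ⟨h, hh⟩ := Q.exists_fundamentalVector_eq z v ((Q.solder_eq_zero_iff z v).1 hv)
  have key (z' : P) (hz : z' = z) (V : TangentSpace 𝓘(ℝ, EP) z') (hV : (V : EP) = (v : EP))
      (h0 : ∀ w, conn.torsionForm z' V w = 0) : conn.torsionForm z v w = 0 := by
    subst hz
    exact (congrArg (fun u ↦ conn.torsionForm z' u w) hV).symm.trans (h0 w)
  refine key _ (Q.act_one z) _ hh fun w ↦ ?_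
  -- The term `ω(v) α(w)` cancels the contribution of `dα`, and `ω(w) α(v)` vanishes.
  rw [torsionForm, Q.extDerivOneForm_solder_fundamentalVector, conn.normalized,
    Q.solder_fundamentalVector, map_zero]
  abel

theorem torsionForm_hor_right (z : P) (v w : TangentSpace 𝓘(ℝ, EP) z) :
    conn.torsionForm z v w = conn.torsionForm z v (conn.hor (Q.solder z w) z) := by
  have h := conn.torsionForm_eq_zero z (v := w - conn.hor (Q.solder z w) z)
    (by rw [map_sub, solder_hor, sub_self]) v
  rw [torsionForm_swap, neg_eq_zero] at h
  conv_lhs => rw [← sub_add_cancel w (conn.hor (Q.solder z w) z), torsionForm_add, h, zero_add]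

end ConnectionForm

end Horizontal

/-! ### The first Bianchi identity on the frame bundle and its contraction -/

section Bianchi

variable {EG EP EM : Type*}
  [NormedAddCommGroup EG] [NormedSpace ℝ EG]
  [NormedAddCommGroup EP] [NormedSpace ℝ EP] [FiniteDimensional ℝ EP]
  [NormedAddCommGroup EM] [NormedSpace ℝ EM]
  {G P M : Type*}
  [TopologicalSpace G] [ChartedSpace EG G] [Group G] [LieGroup 𝓘(ℝ, EG) ∞ G]
  [TopologicalSpace P] [ChartedSpace EP P] [IsManifold 𝓘(ℝ, EP) ∞ P]
  [TopologicalSpace M] [ChartedSpace EM M] [IsManifold 𝓘(ℝ, EM) ∞ M]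
  {p q : ℕ} {Q : OrthonormalFrameBundle EG EP EM G P M p q} (conn : ConnectionForm Q)

namespace ConnectionForm

/-- The bracket of the horizontal vector fields `u_a` and `u_b`. -/
def horBracket (a b : Rpq p q) (z : P) : TangentSpace 𝓘(ℝ, EP) z :=
  mlieBracket 𝓘(ℝ, EP) (conn.hor a) (conn.hor b) z

theorem contMDiffAt_horBracket (a b : Rpq p q) (z : P) :
    ContMDiffAt 𝓘(ℝ, EP) 𝓘(ℝ, EP).tangent 2 (T% (conn.horBracket a b)) z := by
  have : CompleteSpace EP := FiniteDimensional.complete ℝ EP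
  have : IsManifold 𝓘(ℝ, EP) (minSmoothness ℝ 2) P := by
    rw [minSmoothness_of_isRCLikeNormedField]; infer_instance
  have : IsManifold 𝓘(ℝ, EP) (((3 : ℕ∞) : WithTop ℕ∞) + 1) P :=
    .of_le (n := ∞) (WithTop.coe_le_coe.2 le_top)
  refine ContMDiffAt.mlieBracket_vectorField (n := 3) (m := 2)
    ((conn.contMDiff_hor a z).of_le (WithTop.coe_le_coe.2 le_top))
    ((conn.contMDiff_hor b z).of_le (WithTop.coe_le_coe.2 le_top)) ?_
  rw [minSmoothness_of_isRCLikeNormedField]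
  norm_num

theorem mdifferentiableAt_horBracket (a b : Rpq p q) (z : P) :
    MDiffAt (T% (conn.horBracket a b)) z :=
  (conn.contMDiffAt_horBracket a b z).mdifferentiableAt (by simp)

/-- On horizontal fields `ω` vanishes and `α` is constant, so only the bracket term of `dα`
survives; `curvatureForm_hor` is the same computation for `dω`. -/
theorem torsionHat_eq (a b : Rpq p q) (z : P) :
    conn.torsionHat z a b = - Q.solder z (conn.horBracket a b z) := by
  rw [torsionHat, torsionForm, form_hor, form_hor, extDerivOneForm_eq
    (Q.smooth_solder.oneFormMDifferentiableAt z) (conn.mdifferentiableAt_hor a z)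
    (conn.mdifferentiableAt_hor b z)]
  simp only [solder_hor, mvfderiv_const]
  simp [horBracket]

theorem curvatureForm_hor (a b : Rpq p q) (z : P) :
    conn.curvatureForm z (conn.hor a z) (conn.hor b z) = - conn.form z (conn.horBracket a b z) := by
  rw [curvatureForm, form_hor, form_hor, extDerivOneForm_eq
    (conn.smooth.oneFormMDifferentiableAt z) (conn.mdifferentiableAt_hor a z)
    (conn.mdifferentiableAt_hor b z)]
  simp only [form_hor, mvfderiv_const]
  simp [horBracket]

theorem mdifferentiableAt_torsionHat (a b : Rpq p q) (z : P) :
    MDifferentiableAt 𝓘(ℝ, EP) 𝓘(ℝ, Rpq p q) (fun y ↦ conn.torsionHat y a b) z := by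
  simp only [torsionHat_eq]
  exact (Q.smooth_solder.oneFormMDifferentiableAt z (conn.mdifferentiableAt_horBracket a b z)).neg

/-- The linear map `b ↦ Θ̂(a, b)`. -/
def torsionHatHom (z : P) (a : Rpq p q) : Rpq p q →ₗ[ℝ] Rpq p q where
  toFun b := conn.torsionHat z a b
  map_add' b b' := by
    simp only [torsionHat]
    rw [hor_add, torsionForm_add]
  map_smul' c b := by
    simp only [torsionHat]
    rw [hor_smul, torsionForm_smul]
    rfl

theorem torsionHatHom_apply (z : P) (a b : Rpq p q) :
    conn.torsionHatHom z a b = conn.torsionHat z a b := rfl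

theorem torsionHat_swap (z : P) (a b : Rpq p q) :
    conn.torsionHat z a b = - conn.torsionHat z b a :=
  conn.torsionForm_swap z _ _

theorem torsionForm_hor_left (z : P) (a : Rpq p q) (v : TangentSpace 𝓘(ℝ, EP) z) :
    conn.torsionForm z (conn.hor a z) v = conn.torsionHat z a (Q.solder z v) :=
  conn.torsionForm_hor_right z _ _

/-- The solder form on the bracket `[u_c, [u_a, u_b]]`. -/
theorem solder_mlieBracket_horBracket (a b c : Rpq p q) (z : P) :
    Q.solder z (mlieBracket 𝓘(ℝ, EP) (conn.hor c) (conn.horBracket a b) z)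
      = - mvfderiv 𝓘(ℝ, EP) (fun y ↦ conn.torsionHat y a b) z (conn.hor c z)
        + conn.curvatureForm z (conn.hor a z) (conn.hor b z) c
        + conn.torsionHat z c (conn.torsionHat z a b) := by
  -- `Θ(u_c, [u_a, u_b])` is computed twice: by horizontality, and by the formula for `dα`, where
  -- the bracket's vertical part contributes `ω([u_a, u_b]) c`, a curvature term.
  have h1 := conn.torsionForm_hor_left z c (conn.horBracket a b z)
  have h2 : Q.solder z (conn.horBracket a b z) = - conn.torsionHat z a b := by
    rw [torsionHat_eq, neg_neg]
  have h3 : (fun y ↦ Q.solder y (conn.horBracket a b y)) = - fun y ↦ conn.torsionHat y a b := by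
    ext1 y
    rw [Pi.neg_apply, torsionHat_eq, neg_neg]
  rw [torsionForm, form_hor, extDerivOneForm_eq
    (Q.smooth_solder.oneFormMDifferentiableAt z) (conn.mdifferentiableAt_hor c z)
    (conn.mdifferentiableAt_horBracket a b z), h2, h3, ← conn.torsionHatHom_apply z c, map_neg] at h1
  simp only [solder_hor, mvfderiv_const] at h1
  have h4 : mvfderiv 𝓘(ℝ, EP) (-fun y ↦ conn.torsionHat y a b) z (conn.hor c z)
      = - mvfderiv 𝓘(ℝ, EP) (fun y ↦ conn.torsionHat y a b) z (conn.hor c z) :=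
    congrArg (fun L : EP →L[ℝ] Rpq p q ↦ L (conn.hor c z))
      (mvfderiv_neg (I := 𝓘(ℝ, EP)) (g := fun y ↦ conn.torsionHat y a b) (x := z))
  rw [h4, map_neg, torsionHatHom_apply] at h1
  simp only [zero_apply, neg_zero, sub_zero, zero_sub] at h1
  rw [curvatureForm_hor, neg_apply]
  linear_combination (norm := module) -h1

/-- The Jacobi identity, arranged so that each double bracket has the shape treated by
`solder_mlieBracket_horBracket`. -/
theorem jacobi_horBracket (a b c : Rpq p q) (z : P) :
    mlieBracket 𝓘(ℝ, EP) (conn.hor c) (conn.horBracket a b) z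
      = - mlieBracket 𝓘(ℝ, EP) (conn.hor b) (conn.horBracket c a) z
        + mlieBracket 𝓘(ℝ, EP) (conn.hor a) (conn.horBracket c b) z := by
  have : CompleteSpace EP := FiniteDimensional.complete ℝ EP
  have : IsManifold 𝓘(ℝ, EP) (minSmoothness ℝ 3) P := by
    rw [minSmoothness_of_isRCLikeNormedField]
    exact .of_le (n := ∞) (WithTop.coe_le_coe.2 le_top)
  have hs (a : Rpq p q) : ContMDiffAt 𝓘(ℝ, EP) 𝓘(ℝ, EP).tangent (minSmoothness ℝ 2)
      (T% (conn.hor a)) z := by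
    rw [minSmoothness_of_isRCLikeNormedField]
    exact (conn.contMDiff_hor a z).of_le two_le_infty
  have h := leibniz_identity_mlieBracket_apply (hs c) (hs a) (hs b)
  refine h.trans ?_
  rw [mlieBracket_swap_apply]
  rfl

/-- The one-form `tr Θ`, as a combination of the components of the solder form. -/
def trTorsionHom (z : P) : TangentSpace 𝓘(ℝ, EP) z →L[ℝ] ℝ :=
  ∑ b, (∑ c, conn.torsionHat z (stdVec p q c) (stdVec p q b) c) •
    (ContinuousLinearMap.proj b ∘L Q.solder z)

theorem trTorsionForm_eq (z : P) (v : TangentSpace 𝓘(ℝ, EP) z) :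
    conn.trTorsionForm z v = ∑ c, conn.torsionHat z (stdVec p q c) (Q.solder z v) c := by
  simp only [trTorsionForm, torsionForm_hor_left]

theorem trTorsionHom_apply (z : P) (v : TangentSpace 𝓘(ℝ, EP) z) :
    conn.trTorsionHom z v = conn.trTorsionForm z v := by
  rw [trTorsionForm_eq]
  have h : Q.solder z v = ∑ b, Q.solder z v b • stdVec p q b := by
    simpa [stdVec] using pi_eq_sum_univ' (Q.solder z v)
  conv_rhs => rw [h]
  simp only [← torsionHatHom_apply, map_sum, map_smul]
  simp only [trTorsionHom, Finset.sum_apply, Pi.smul_apply, smul_eq_mul]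
  rw [Finset.sum_comm, sum_apply]
  refine Finset.sum_congr rfl fun b _ ↦ ?_
  rw [← Finset.mul_sum, mul_comm]
  rfl

theorem mdifferentiableAt_torsionHat_apply (a b : Rpq p q) (c : Fin p ⊕ Fin q) (z : P) :
    MDifferentiableAt 𝓘(ℝ, EP) 𝓘(ℝ, ℝ) (fun y ↦ conn.torsionHat y a b c) z :=
  (ContinuousLinearMap.proj (R := ℝ) (φ := fun _ : Fin p ⊕ Fin q ↦ ℝ) c).mdifferentiableAt.comp z
    (conn.mdifferentiableAt_torsionHat a b z)

theorem mdifferentiableAt_trTorsionHom (z : P) : OneFormMDifferentiableAt conn.trTorsionHom z := by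
  intro X hX
  have hα := Q.smooth_solder.oneFormMDifferentiableAt z hX
  have e : (fun y ↦ conn.trTorsionHom y (X y)) = ∑ b, (∑ c,
      fun y ↦ conn.torsionHat y (stdVec p q c) (stdVec p q b) c) * fun y ↦ Q.solder y (X y) b := by
    ext y
    simp only [trTorsionHom, sum_apply, Finset.sum_apply, Pi.mul_apply]
    rfl
  rw [e]
  refine MDifferentiableAt.sum fun b _ ↦ ?_
  refine (MDifferentiableAt.sum fun c _ ↦ conn.mdifferentiableAt_torsionHat_apply _ _ c z).mul ?_
  exact (ContinuousLinearMap.proj (R := ℝ) (φ := fun _ : Fin p ⊕ Fin q ↦ ℝ)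
    b).mdifferentiableAt.comp z hα

theorem mvfderiv_sum_torsionHat (a : Rpq p q) (z : P) (v : TangentSpace 𝓘(ℝ, EP) z) :
    mvfderiv 𝓘(ℝ, EP) (fun y ↦ ∑ c, conn.torsionHat y (stdVec p q c) a c) z v
      = ∑ c, mvfderiv 𝓘(ℝ, EP) (fun y ↦ conn.torsionHat y (stdVec p q c) a) z v c := by
  have h := (mvfderiv_sum_repr (Pi.basisFun ℝ (Fin p ⊕ Fin q)) Finset.univ
    (fun c ↦ conn.mdifferentiableAt_torsionHat (stdVec p q c) a z) v).2
  simpa using h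

/-- The last sum is `-tr Θ([u_a, u_b])`; it absorbs one of the three quadratic terms of the Bianchi
identity. -/
theorem extDerivTrTorsionHat_eq (z : P) (a b : Fin p ⊕ Fin q) :
    conn.extDerivTrTorsionHat z a b
      = ∑ c, mvfderiv 𝓘(ℝ, EP) (fun y ↦ conn.torsionHat y (stdVec p q c) (stdVec p q b)) z
          (conn.hor (stdVec p q a) z) c
        - ∑ c, mvfderiv 𝓘(ℝ, EP) (fun y ↦ conn.torsionHat y (stdVec p q c) (stdVec p q a)) z
          (conn.hor (stdVec p q b) z) c
        + ∑ c, conn.torsionHat z (stdVec p q c)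
          (conn.torsionHat z (stdVec p q a) (stdVec p q b)) c := by
  have h := extDerivOneForm_eq (conn.mdifferentiableAt_trTorsionHom z)
    (conn.mdifferentiableAt_hor (stdVec p q a) z) (conn.mdifferentiableAt_hor (stdVec p q b) z)
  simp only [trTorsionHom_apply, trTorsionForm_eq, solder_hor, mvfderiv_sum_torsionHat] at h
  have h0 : conn.trTorsionForm = fun z v ↦ ∑ c, conn.torsionHat z (stdVec p q c) (Q.solder z v) c :=
    funext fun z ↦ funext fun v ↦ conn.trTorsionForm_eq z v
  have h2 : Q.solder z (mlieBracket 𝓘(ℝ, EP) (conn.hor (stdVec p q a)) (conn.hor (stdVec p q b)) z)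
      = - conn.torsionHat z (stdVec p q a) (stdVec p q b) := by
    rw [torsionHat_eq, neg_neg]
    rfl
  rw [extDerivTrTorsionHat, h0, h, h2]
  simp only [← torsionHatHom_apply, map_neg, Pi.neg_apply, Finset.sum_neg_distrib, sub_neg_eq_add]

theorem divTorsionHat_eq (z : P) (a b : Fin p ⊕ Fin q) :
    conn.divTorsionHat z a b
      = ∑ c, mvfderiv 𝓘(ℝ, EP) (fun y ↦ conn.torsionHat y (stdVec p q a) (stdVec p q b)) z
          (conn.hor (stdVec p q c) z) c := by
  refine Finset.sum_congr rfl fun c _ ↦ ?_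
  have h0 (a : Rpq p q) : conn.torsionHat z a 0 = 0 := (conn.torsionHatHom z a).map_zero
  have h0' (a : Rpq p q) : conn.torsionHat z 0 a = 0 := by rw [torsionHat_swap, h0, neg_zero]
  rw [covDiffTorsionHat, form_hor]
  simp only [zero_apply, h0, h0', sub_zero, add_zero]

/-- The first Bianchi identity, evaluated on the horizontal vector fields. -/
theorem bianchi (z : P) (a b c : Rpq p q) :
    - mvfderiv 𝓘(ℝ, EP) (fun y ↦ conn.torsionHat y a b) z (conn.hor c z)
        + conn.curvatureForm z (conn.hor a z) (conn.hor b z) c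
        + conn.torsionHat z c (conn.torsionHat z a b)
      = - (- mvfderiv 𝓘(ℝ, EP) (fun y ↦ conn.torsionHat y c a) z (conn.hor b z)
        + conn.curvatureForm z (conn.hor c z) (conn.hor a z) b
        + conn.torsionHat z b (conn.torsionHat z c a))
      + (- mvfderiv 𝓘(ℝ, EP) (fun y ↦ conn.torsionHat y c b) z (conn.hor a z)
        + conn.curvatureForm z (conn.hor c z) (conn.hor b z) a
        + conn.torsionHat z a (conn.torsionHat z c b)) := by
  have h := congrArg (Q.solder z) (conn.jacobi_horBracket a b c z)
  rw [map_add, map_neg] at h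
  simpa only [solder_mlieBracket_horBracket] using h

/-- Up to sign both sides are traces of `Θ̂(a, ·) ∘ Θ̂(b, ·)` in the two orders; this cancels the
other two quadratic terms. -/
theorem sum_torsionHat_torsionHat_comm (z : P) (a b : Rpq p q) :
    ∑ c, conn.torsionHat z a (conn.torsionHat z (stdVec p q c) b) c
      = ∑ c, conn.torsionHat z b (conn.torsionHat z (stdVec p q c) a) c := by
  have h (a b : Rpq p q) : ∑ c, conn.torsionHat z a (conn.torsionHat z (stdVec p q c) b) c
      = - LinearMap.trace ℝ _ (conn.torsionHatHom z a ∘ₗ conn.torsionHatHom z b) := by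
    rw [LinearMap.trace_eq_sum_repr (Pi.basisFun ℝ (Fin p ⊕ Fin q)), ← Finset.sum_neg_distrib]
    refine Finset.sum_congr rfl fun c _ ↦ ?_
    rw [conn.torsionHat_swap z _ b, ← torsionHatHom_apply, map_neg, Pi.neg_apply,
      Pi.basisFun_repr, Pi.basisFun_apply]
    rfl
  rw [h, h, LinearMap.trace_comp_comm']

/-- The contracted Bianchi identity on the frame bundle. -/
theorem ricciHat_sub_ricciHat (z : P) (a b : Fin p ⊕ Fin q) :
    conn.ricciHat z a b - conn.ricciHat z b a
      = conn.divTorsionHat z a b - conn.extDerivTrTorsionHat z a b := by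
  -- Contraction: the third argument is the basis vector `e_c`, the component taken is the `c`-th,
  -- and `c` is summed.
  have h := Finset.sum_congr (s₁ := Finset.univ) rfl fun c _ ↦
    congrFun (conn.bianchi z (stdVec p q a) (stdVec p q b) (stdVec p q c)) c
  -- The curvature is minus a value of `ω`, hence in `𝔰𝔬(p, q)`, so its diagonal entries vanish.
  have h0 (c : Fin p ⊕ Fin q) : conn.curvatureForm z (conn.hor (stdVec p q a) z)
      (conn.hor (stdVec p q b) z) (stdVec p q c) c = 0 := by
    rw [curvatureForm_hor, neg_apply, Pi.neg_apply,
      (conn.skew z (conn.horBracket _ _ z)).apply_stdVec c, neg_zero]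
  simp only [Pi.add_apply, Pi.neg_apply, Finset.sum_add_distrib, Finset.sum_neg_distrib, h0,
    Finset.sum_const_zero] at h
  have h1 := conn.sum_torsionHat_torsionHat_comm z (stdVec p q a) (stdVec p q b)
  rw [divTorsionHat_eq, extDerivTrTorsionHat_eq]
  simp only [ricciHat, ricciForm]
  linarith

end ConnectionForm

end Bianchi

end

/-- The contracted Bianchi identity, on the base manifold for a metric connection, and on the
orthonormal frame bundle for a connection form. -/
theorem mainTheorem5 {n : ℕ} (M : Type*) [TopologicalSpace M] [T2Space M]
    [ChartedSpace (EuclideanSpace ℝ (Fin n)) M] [IsManifold (𝓡 n) ∞ M] :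
    (∀ (g : PseudoRiemannianMetric (EuclideanSpace ℝ (Fin n)) M)
      (cov : CovariantDerivative (𝓡 n) (EuclideanSpace ℝ (Fin n))
        (TangentSpace (𝓡 n) : M → Type _))
      [CovariantDerivative.ContMDiffCovariantDerivative cov ∞],
      g.IsCompatible cov → ∀ (x : M) (v w : TangentSpace (𝓡 n) x),
        ricci cov x v w - ricci cov x w v
          = divTorsion cov x v w - extDerivOneForm (trTorsion cov) x v w) ∧
    (∀ {p q k m : ℕ} (G P : Type*)
      [TopologicalSpace G] [ChartedSpace (EuclideanSpace ℝ (Fin k)) G] [Group G]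
      [LieGroup (𝓡 k) ∞ G]
      [TopologicalSpace P] [ChartedSpace (EuclideanSpace ℝ (Fin m)) P] [IsManifold (𝓡 m) ∞ P]
      (Q : OrthonormalFrameBundle (EuclideanSpace ℝ (Fin k)) (EuclideanSpace ℝ (Fin m))
        (EuclideanSpace ℝ (Fin n)) G P M p q)
      (conn : ConnectionForm Q) (z : P) (a b : Fin p ⊕ Fin q),
        conn.ricciHat z a b - conn.ricciHat z b a
          = conn.divTorsionHat z a b - conn.extDerivTrTorsionHat z a b) := by
  refine ⟨fun _ cov _ hg x v w ↦ ricci_sub_ricci cov hg x v w, ?_⟩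
  intro p q k m G P _ _ _ _ _ _ _ Q conn z a b
  exact conn.ricciHat_sub_ricciHat z a b
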